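/- Let $\ell,r\ge 0$ be integers (the case of interest is $\ell\ge2$, $r\ge1$). Let $\Gamma$ be the free abelian group with basis $v_1,\dots,v_\ell,\theta_1,\dots,\theta_r,\Theta_1,\dots,\Theta_r$ and symmetric bilinear form $(v_i|v_j)=\delta_{ij}$, $(\theta_\nu|\Theta_\mu)=\delta_{\nu\mu}$, all other products of basis vectors being $0$. Let $\varepsilon:\Gamma\times\Gamma\to\{\pm1\}$ be bimultiplicative with $\varepsilon(v_i,v_j)=\varepsilon_{ij}$, where $\varepsilon_{ij}=1$ for $i<j$ and $\varepsilon_{ij}=-1$ for $i\ge j$, with $\varepsilon(\theta_\nu,\Theta_\mu)=(-1)^{\delta_{\nu\mu}}$, with $\varepsilon(\Theta_\mu,\theta_\nu)\in\{\pm1\}$ arbitrary (the choice $1$ gives a vertex algebra), and with $\varepsilon=1$ on all other pairs of basis vectors. Put $\mathfrak h=\mathbb C\otimes_{\mathbb Z}\Gamma$, let $S$ be the symmetric algebra of $\bigoplus_{n<0}\mathfrak h s^n$, and let $V_\Gamma=S\otimes\mathbb C_\varepsilon[\Gamma]$, with vacuum $|0\rangle=1\otimes e^0$. For $h\in\mathfrak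 h$ let $h_{(n)}$ act on $g\otimes e^\beta$ as multiplication by $hs^{n}$ for $n<0$, as the scalar $(h|\beta)$ for $n=0$, and for $n>0$ as the derivation of $S$ with $h's^{-k}\mapsto\delta_{k,n}\,n\,(h|h')$. Put $h(z)=\sum_n h_{(-n)}z^{n-1}$ and $$E^\alpha(z)=e^\alpha z^{\alpha_{(0)}}\exp\Big(\sum_{n>0}\alpha_{(-n)}\tfrac{z^n}{n}\Big)\exp\Big(\sum_{n<0}\alpha_{(-n)}\tfrac{z^n}{n}\Big),\qquad e^\alpha(g\otimes e^\beta)=\varepsilon(\alpha,\beta)\,g\otimes e^{\alpha+\beta}.$$ The state-field correspondence is the linear map with $$Y(h_1s^{-m_1-1}\cdots h_ks^{-m_k-1}\otimes e^\alpha,z)=\tfrac1{m_1!\cdots m_k!}:\partial_z^{m_1}h_1(z)\cdots\partial_z^{m_k}h_k(z)\,E^\alpha(z):,$$ where the normally ordered product is nested from the right and $:D(z)A(z):=D(z)_{\ge0}A(z)+A(z)D(z)_{<0}$ (splitting by powers of $z$). Write $Y(a,z)=\sum_m a_{(m)}z^{-m-1}$ and $p\cdot\theta=\sum_\nu p_\nu\theta_\nu$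 for $p\in\mathbb Z^r$. Let $\mathfrak g^{\rm tor}$ be the complex Lie algebra of operators on $V_\Gamma$ generated by $$\big((v_i-v_{i+1})s^{-1}\otimes e^{p\cdot\theta}\big)_{(m)},\quad \varepsilon_{lk}\big(1\otimes e^{v_k-v_l+p\cdot\theta}\big)_{(m)},\quad \big(1\otimes e^{p\cdot\theta}\big)_{(m-1)},\quad \big(\theta_\nu s^{-1}\otimes e^{p\cdot\theta}\big)_{(m)}$$ for $1\le i<\ell$, $1\le k\ne l\le\ell$, $1\le\nu\le r$, $m\in\mathbb Z$, $p\in\mathbb Z^r$. For $\Omega^{\rm tor}=\sum_{k=1}^{\ell}\sum_{q\in\mathbb Z^r}e^{v_k+q\cdot\theta}\boxtimes e^{-v_k-q\cdot\theta}$ define $$\Omega^{\rm tor}_{(m)}=\sum_{k=1}^\ell\sum_{q\in\mathbb Z^r}\sum_{j\in\mathbb Z}(e^{v_k+q\cdot\theta})_{(j)}\boxtimes(e^{-v_k-q\cdot\theta})_{(m-j-1)},$$ a linear map from $V_\Gamma\otimes V_\Gamma$ to its completion $\prod_{\beta,\gamma\in\Gamma}(S\otimes e^\beta)\otimes(S\otimes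 e^\gamma)$. (On a given vector, only finitely many terms of the sum over $q$ contribute to each component, and for each $q$ only finitely many $j$.) **Theorem.** Let $X\in\mathfrak g^{\rm tor}$. 1. If the series $e^X|0\rangle=\sum_{n\ge0}\frac{1}{n!}X^n|0\rangle$ converges in $V_\Gamma$ to a vector $Z$ (that is, $\sum_n\frac1{n!}f(X^n|0\rangle)=f(Z)$ for every linear functional $f$ on $V_\Gamma$), then $$\Omega^{\rm tor}_{(m)}(Z\otimes Z)=0\qquad\text{for all integers } m\ge0.$$ 2. Without any convergence condition, the same holds for the formal exponential $Z(t)=e^{tX}|0\rangle\in V_\Gamma[[t]]$: for all integers $m\ge0$ and $n\ge0$, $$\Omega^{\rm tor}_{(m)}\Big(\sum_{i+j=n}\frac{X^i|0\rangle}{i!}\otimes\frac{X^j|0\rangle}{j!}\Big)=0.$$ -/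

import Mathlib

open scoped TensorProduct

attribute [local instance] LieRing.ofAssociativeRing

set_option linter.unusedSectionVars false

noncomputable section

namespace ToroidalVertex

/-! ### Locally finite sums of linear maps -/

section LocallyFinite

variable {κ V W : Type*} [AddCommMonoid V] [Module ℂ V] [AddCommMonoid W] [Module ℂ W]

/-- A family of linear maps is locally finite if only finitely many of its members are nonzero
on any given vector. -/
def LocFin (F : κ → V →ₗ[ℂ] W) : Prop :=
  ∀ v, (Function.support fun i => F i v).Finite

/-- The sum of a locally finite family of linear maps, taken vector by vector. -/
def locSum (F : κ → V →ₗ[ℂ] W) (hF : LocFin F) : V →ₗ[ℂ] W where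
  toFun v := ∑ᶠ i, F i v
  map_add' u v := by
    simp only [map_add]
    exact finsum_add_distrib (hF u) (hF v)
  map_smul' c v := by
    simp only [map_smul, RingHom.id_apply]
    exact (smul_finsum' c (hF v)).symm

end LocallyFinite

/-! ### The polynomial Fock space

`ι` indexes a `ℤ`-basis `(b_i)` of the lattice `ι → ℤ`, and `ι → ℂ` is its complexification `𝔥`. -/

section Fock

variable {ι : Type} [Fintype ι] [DecidableEq ι]

/-- The symmetric algebra of `⨁_{n < 0} 𝔥 s^n`: a polynomial ring, in which the variable
`X (i, n)` is `b_i s^{-(n+1)}`. -/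
abbrev Sym (ι : Type) : Type := MvPolynomial (ι × ℕ) ℂ

/-- The state space `V = S ⊗ ℂ_ε[ι → ℤ]`; the vector `g ⊗ e^β` is `Finsupp.single β g`. -/
abbrev Fock (ι : Type) : Type := (ι → ℤ) →₀ Sym ι

/-- The vacuum vector `1 ⊗ e^0`. -/
def vac (ι : Type) : Fock ι := Finsupp.single 0 1

/-- The inclusion of the lattice into `𝔥`. -/
def toC (α : ι → ℤ) : ι → ℂ := fun i => (α i : ℂ)

/-- The bilinear form on the lattice with Gram matrix `B`. -/
def latForm (B : Matrix ι ι ℤ) (α β : ι → ℤ) : ℤ := ∑ i, ∑ j, α i * B i j * β j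

/-- The complex bilinear extension of `latForm B` to `𝔥`. -/
def hForm (B : Matrix ι ι ℤ) (h h' : ι → ℂ) : ℂ := ∑ i, ∑ j, h i * (B i j : ℂ) * h' j

/-- The bimultiplicative function with prescribed values `E i j` on pairs of basis vectors. -/
def bimult (E : ι → ι → ℤˣ) (α β : ι → ℤ) : ℤˣ := ∏ i, ∏ j, E i j ^ (α i * β j)

/-- The element `h s^{-(n+1)}` of the symmetric algebra. -/
def hs (h : ι → ℂ) (n : ℕ) : Sym ι := ∑ i, MvPolynomial.C (h i) * MvPolynomial.X (i, n)

/-- The action of `h_(-(n+1))` on the symmetric algebra: multiplication by `h s^{-(n+1)}`. -/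
def creat (h : ι → ℂ) (n : ℕ) : Module.End ℂ (Sym ι) := LinearMap.mulLeft ℂ (hs h n)

/-- The action of `h_(n+1)` on the symmetric algebra: the derivation that sends `h' s^{-(n+1)}` to
`(n+1) (h|h')` and `h' s^{-(k+1)}` to `0` for `k ≠ n`. -/
def annih (B : Matrix ι ι ℤ) (h : ι → ℂ) (n : ℕ) : Module.End ℂ (Sym ι) :=
  ∑ i, (((n : ℂ) + 1) * hForm B h (Pi.single i 1)) • (MvPolynomial.pderiv (i, n)).toLinearMap

/-- The operator `h_(n)` on the state space, `n ∈ ℤ`. -/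
def heis (B : Matrix ι ι ℤ) (h : ι → ℂ) : ℤ → Module.End ℂ (Fock ι)
  | Int.ofNat 0 =>
      Finsupp.lsum ℂ fun β => hForm B h (toC β) • Finsupp.lsingle β
  | Int.ofNat (n + 1) => Finsupp.mapRange.linearMap (annih B h n)
  | Int.negSucc n => Finsupp.mapRange.linearMap (creat h n)

/-- The coefficient of `x^n` in `exp f = ∑_j f^j / j!`, for a power series `f` without constant
term (so that `f^j` does not contribute for `j > n`). -/
def expCoeff {A : Type*} [Ring A] [Algebra ℂ A] (f : PowerSeries A) (n : ℕ) : A :=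
  ∑ j ∈ Finset.range (n + 1), ((Nat.factorial j : ℂ))⁻¹ • PowerSeries.coeff n (f ^ j)

/-- The exponent `∑_{n > 0} α_(-n) z^n / n`, a power series in `z`. -/
def plusExponent (h : ι → ℂ) : PowerSeries (Module.End ℂ (Sym ι)) :=
  PowerSeries.mk fun n => match n with
    | 0 => 0
    | n + 1 => ((n : ℂ) + 1)⁻¹ • creat h n

/-- The exponent `∑_{n < 0} α_(-n) z^n / n = - ∑_{n > 0} α_(n) z^{-n} / n`, a power series
in `z⁻¹`. -/
def minusExponent (B : Matrix ι ι ℤ) (h : ι → ℂ) : PowerSeries (Module.End ℂ (Sym ι)) :=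
  PowerSeries.mk fun n => match n with
    | 0 => 0
    | n + 1 => (-((n : ℂ) + 1)⁻¹) • annih B h n

/-! Helper facts: annihilation operators lower the weight, so the series below act locally
finitely. -/

/-- The weight of a monomial; `b_i s^{-(n+1)}` has weight `n + 1`. -/
def wt (d : ι × ℕ →₀ ℕ) : ℤ := d.sum fun p e => (e : ℤ) * ((p.2 : ℤ) + 1)

theorem wt_nonneg (d : ι × ℕ →₀ ℕ) : 0 ≤ wt d :=
  Finset.sum_nonneg fun _ _ => by positivity

theorem wt_add_single (d : ι × ℕ →₀ ℕ) (p : ι × ℕ) :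
    wt (d + Finsupp.single p 1) = wt d + (p.2 + 1) := by
  unfold wt
  rw [Finsupp.sum_add_index' (by simp) (by intros; push_cast; ring)]
  simp

/-- Polynomials of weight at most `n`. -/
def HasWt (n : ℤ) (g : Sym ι) : Prop := ∀ d, g.coeff d ≠ 0 → wt d ≤ n

theorem exists_hasWt (g : Sym ι) : ∃ n : ℕ, HasWt (n : ℤ) g := by
  refine ⟨∑ d ∈ g.support, (wt d).toNat, fun d hd => ?_⟩
  have h := Finset.single_le_sum (f := fun d => (wt d).toNat) (fun _ _ => Nat.zero_le _)
    (MvPolynomial.mem_support_iff.mpr hd)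
  have h2 := Int.self_le_toNat (wt d)
  omega

theorem HasWt.eq_zero {n : ℤ} {g : Sym ι} (h : HasWt n g) (hn : n < 0) : g = 0 := by
  ext d
  by_contra hd
  have h1 := h d (by simpa using hd)
  have h2 := wt_nonneg d
  omega

/-- Operators that lower the weight by at least `b`. -/
def lowers (ι : Type) (b : ℤ) : Submodule ℂ (Module.End ℂ (Sym ι)) where
  carrier := {A | ∀ n g, HasWt n g → HasWt (n - b) (A g)}
  add_mem' := by
    intro A A' hA hA' n g hg d hd
    by_cases h : (A g).coeff d = 0
    · exact hA' n g hg d fun h' => hd (by simp [h, h'])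
    · exact hA n g hg d h
  zero_mem' := by
    intro n g _ d hd
    simp at hd
  smul_mem' := by
    intro c A hA n g hg d hd
    exact hA n g hg d fun h' => hd (by simp [h'])

theorem lowers_mul {a b : ℤ} {A A' : Module.End ℂ (Sym ι)} (hA : A ∈ lowers ι a)
    (hA' : A' ∈ lowers ι b) : A * A' ∈ lowers ι (a + b) := by
  intro n g hg
  have h := hA _ _ (hA' n g hg)
  rwa [sub_sub, add_comm b a] at h

theorem annih_mem (B : Matrix ι ι ℤ) (h : ι → ℂ) (n : ℕ) :
    annih B h n ∈ lowers ι ((n : ℤ) + 1) := by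
  refine Submodule.sum_mem _ fun i _ => Submodule.smul_mem _ _ ?_
  intro k g hg d hd
  have h1 : (MvPolynomial.pderiv (i, n) g).coeff d ≠ 0 := hd
  rw [MvPolynomial.coeff_pderiv] at h1
  have h2 := hg _ (left_ne_zero_of_mul h1)
  rw [wt_add_single] at h2
  simp only at h2
  omega

theorem expCoeff_mem (B : Matrix ι ι ℤ) (h : ι → ℂ) (n : ℕ) :
    expCoeff (minusExponent B h) n ∈ lowers ι (n : ℤ) := by
  refine Submodule.sum_mem _ fun j hj => Submodule.smul_mem _ _ ?_
  clear hj
  induction j generalizing n with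
  | zero =>
    rw [pow_zero, PowerSeries.coeff_one]
    split_ifs with h0
    · subst h0
      intro n g hg
      simpa using hg
    · exact Submodule.zero_mem _
  | succ j ih =>
    rw [pow_succ, PowerSeries.coeff_mul]
    refine Submodule.sum_mem _ fun p hp => ?_
    have hp' := Finset.HasAntidiagonal.mem_antidiagonal.mp hp
    rw [← hp']
    push_cast
    refine lowers_mul (ih _) ?_
    rw [minusExponent, PowerSeries.coeff_mk]
    rcases hq : p.2 with _ | q
    · exact Submodule.zero_mem _
    · refine Submodule.smul_mem _ _ ?_
      have := annih_mem B h q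
      push_cast
      exact this

theorem exists_expCoeff_zero (B : Matrix ι ι ℤ) (h : ι → ℂ) (g : Sym ι) :
    ∃ N : ℕ, ∀ b : ℕ, N < b → expCoeff (minusExponent B h) b g = 0 := by
  obtain ⟨N, hN⟩ := exists_hasWt g
  exact ⟨N, fun b hb => (expCoeff_mem B h b _ g hN).eq_zero (by omega)⟩

/-- The contribution of the pair `(a, b)` to the coefficient of `z^j` in
`exp (∑_{n > 0} α_(-n) z^n / n) exp (∑_{n < 0} α_(-n) z^n / n)`. -/
def expTerm (B : Matrix ι ι ℤ) (h : ι → ℂ) (j : ℤ) (p : ℕ × ℕ) : Module.End ℂ (Sym ι) :=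
  if (p.1 : ℤ) - p.2 = j then
    expCoeff (plusExponent h) p.1 ∘ₗ expCoeff (minusExponent B h) p.2
  else 0

theorem expTerm_locFin (B : Matrix ι ι ℤ) (h : ι → ℂ) (j : ℤ) : LocFin (expTerm B h j) := by
  intro g
  obtain ⟨N, hN⟩ := exists_expCoeff_zero B h g
  refine ((Set.finite_Iic N).image fun b : ℕ => ((j + b).toNat, b)).subset ?_
  rintro ⟨a, b⟩ hab
  simp only [Function.mem_support, expTerm] at hab
  split_ifs at hab with h1
  · refine ⟨b, ?_, ?_⟩
    · by_contra hb
      exact hab (by simp [hN b (by simpa using hb)])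
    · simp only [Prod.mk.injEq, and_true]
      omega
  · simp at hab

/-- The coefficient of `z^j` in
`exp (∑_{n > 0} α_(-n) z^n / n) exp (∑_{n < 0} α_(-n) z^n / n)`. -/
def expProd (B : Matrix ι ι ℤ) (h : ι → ℂ) (j : ℤ) : Module.End ℂ (Sym ι) :=
  locSum (expTerm B h j) (expTerm_locFin B h j)

theorem expProd_bdd (B : Matrix ι ι ℤ) (h : ι → ℂ) (g : Sym ι) :
    ∃ N : ℤ, ∀ j < N, expProd B h j g = 0 := by
  obtain ⟨N, hN⟩ := exists_expCoeff_zero B h g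
  refine ⟨-N, fun j hj => ?_⟩
  refine finsum_eq_zero_of_forall_eq_zero fun p => ?_
  unfold expTerm
  split_ifs with h1
  · simp [hN p.2 (by omega)]
  · simp

/-- The coefficient of `z^n` in
`E^α(z) = e^α z^{α_(0)} exp (∑_{n > 0} α_(-n) z^n / n) exp (∑_{n < 0} α_(-n) z^n / n)`,
where `e^α (g ⊗ e^β) = ε(α, β) g ⊗ e^{α + β}` and `z^{α_(0)} (g ⊗ e^β) = z^{(α|β)} g ⊗ e^β`. -/
def expFieldCoeff (B : Matrix ι ι ℤ) (E : ι → ι → ℤˣ) (α : ι → ℤ) (n : ℤ) :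
    Module.End ℂ (Fock ι) :=
  Finsupp.lsum ℂ fun β => (((bimult E α β : ℤˣ) : ℤ) : ℂ) •
    (Finsupp.lsingle (α + β) ∘ₗ expProd B (toC α) (n - latForm B α β))

theorem bddBelow_of {V : Type*} [Zero V] {f : ℤ → V} {N : ℤ} (h : ∀ j < N, f j = 0) :
    BddBelow (Function.support f) :=
  ⟨N, fun j hj => by
    by_contra hlt
    exact hj (h j (not_le.mp hlt))⟩

theorem exists_of_bddBelow {V : Type*} [Zero V] {f : ℤ → V}
    (h : BddBelow (Function.support f)) : ∃ N, ∀ j < N, f j = 0 := by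
  obtain ⟨N, hN⟩ := h
  refine ⟨N, fun j hj => ?_⟩
  by_contra hne
  exact absurd (hN hne) (not_le.mpr hj)

theorem expFieldCoeff_bdd (B : Matrix ι ι ℤ) (E : ι → ι → ℤˣ) (α : ι → ℤ) (v : Fock ι) :
    BddBelow (Function.support fun n => expFieldCoeff B E α n v) := by
  induction v using Finsupp.induction_linear with
  | zero => simp
  | add u v hu hv =>
    refine (hu.union hv).mono ?_
    simp only [map_add]
    exact Function.support_add _ _
  | single β g =>
    obtain ⟨N, hN⟩ := expProd_bdd B (toC α) g
    refine bddBelow_of (N := N + latForm B α β) fun j hj => ?_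
    simp [expFieldCoeff, hN (j - latForm B α β) (by omega)]

/-- The field `E^α(z)`. -/
def expField (B : Matrix ι ι ℤ) (E : ι → ι → ℤˣ) (α : ι → ℤ) : VertexOperator ℂ (Fock ι) :=
  VertexOperator.of_coeff (expFieldCoeff B E α) (expFieldCoeff_bdd B E α)

/-- The coefficient of `z^j` in `∂_z^m h(z) / m!`, where `h(z) = ∑_n h_(-n) z^{n-1}`. -/
def divDeriv (B : Matrix ι ι ℤ) (h : ι → ℂ) (m : ℕ) (j : ℤ) : Module.End ℂ (Fock ι) :=
  (Ring.choose (j + m) m : ℤ) • heis B h (-(j + m) - 1)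

theorem heis_eventually (B : Matrix ι ι ℤ) (h : ι → ℂ) (v : Fock ι) :
    ∃ N : ℕ, ∀ n : ℤ, N < n → heis B h n v = 0 := by
  induction v using Finsupp.induction_linear with
  | zero => exact ⟨0, by simp⟩
  | add u v hu hv =>
    obtain ⟨M, hM⟩ := hu
    obtain ⟨N, hN⟩ := hv
    refine ⟨M + N, fun n hn => ?_⟩
    rw [map_add, hM n (by omega), hN n (by omega), add_zero]
  | single β g =>
    obtain ⟨N, hN⟩ := exists_hasWt g
    refine ⟨N, fun n hn => ?_⟩
    obtain ⟨k, rfl⟩ : ∃ k : ℕ, n = Int.ofNat (k + 1) := ⟨(n - 1).toNat, by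
      simp only [Int.ofNat_eq_natCast]; omega⟩
    have h0 : annih B h k g = 0 := (annih_mem B h k _ g hN).eq_zero (by
      simp only [Int.ofNat_eq_natCast] at hn; omega)
    simp [heis, h0]

theorem divDeriv_eventually (B : Matrix ι ι ℤ) (h : ι → ℂ) (m : ℕ) (v : Fock ι) :
    ∃ N : ℕ, ∀ j : ℕ, N < j → divDeriv B h m (-(j + 1)) v = 0 := by
  obtain ⟨N, hN⟩ := heis_eventually B h v
  refine ⟨N + m, fun j hj => ?_⟩
  rw [divDeriv, LinearMap.smul_apply, hN _ (by omega), smul_zero]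

variable (B : Matrix ι ι ℤ) (h : ι → ℂ) (m : ℕ) (A : VertexOperator ℂ (Fock ι))

theorem coeff_bdd (v : Fock ι) : ∃ N, ∀ n < N, HVertexOperator.coeff A n v = 0 :=
  ⟨_, fun n hn => VertexOperator.coeff_eq_zero_of_lt_order A n v hn⟩

theorem normalPlus_locFin (n : ℤ) :
    LocFin fun j : ℕ => divDeriv B h m j ∘ₗ HVertexOperator.coeff A (n - j) := by
  intro v
  obtain ⟨N, hN⟩ := coeff_bdd A v
  refine (Set.finite_Iic (n - N).toNat).subset fun j hj => ?_
  by_contra hlt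
  rw [Set.mem_Iic, not_le] at hlt
  exact hj (by
    simp only [LinearMap.comp_apply]
    rw [hN _ (by omega), map_zero])

theorem normalMinus_locFin (n : ℤ) :
    LocFin fun j : ℕ => HVertexOperator.coeff A (n + (j + 1)) ∘ₗ divDeriv B h m (-(j + 1)) := by
  intro v
  obtain ⟨N, hN⟩ := divDeriv_eventually B h m v
  refine (Set.finite_Iic N).subset fun j hj => ?_
  by_contra hlt
  rw [Set.mem_Iic, not_le] at hlt
  exact hj (by
    simp only [LinearMap.comp_apply]
    rw [hN _ hlt, map_zero])

/-- The coefficient of `z^n` in the normally ordered product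
`:D(z) A(z): = D(z)_{≥ 0} A(z) + A(z) D(z)_{< 0}` with `D(z) = ∂_z^m h(z) / m!`. -/
def normalCoeff (n : ℤ) : Module.End ℂ (Fock ι) :=
  locSum _ (normalPlus_locFin B h m A n) + locSum _ (normalMinus_locFin B h m A n)

theorem normalCoeff_bdd (v : Fock ι) :
    BddBelow (Function.support fun n => normalCoeff B h m A n v) := by
  obtain ⟨N, hN⟩ := coeff_bdd A v
  obtain ⟨K, hK⟩ := divDeriv_eventually B h m v
  choose f hf using fun j : ℕ => coeff_bdd A (divDeriv B h m (-(j + 1)) v)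
  obtain ⟨M, hM⟩ : BddBelow (f '' Set.Iic K) := ((Set.finite_Iic K).image f).bddBelow
  refine bddBelow_of (N := min N (M - (K + 1))) fun n hn => ?_
  have hn1 := lt_of_lt_of_le hn (min_le_left _ _)
  have hn2 := lt_of_lt_of_le hn (min_le_right _ _)
  have e1 : locSum _ (normalPlus_locFin B h m A n) v = 0 :=
    finsum_eq_zero_of_forall_eq_zero fun j => by
      rw [LinearMap.comp_apply, hN _ (by omega), map_zero]
  have e2 : locSum _ (normalMinus_locFin B h m A n) v = 0 :=
    finsum_eq_zero_of_forall_eq_zero fun j => by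
      rw [LinearMap.comp_apply]
      by_cases hj : K < j
      · rw [hK j hj, map_zero]
      · have := hM ⟨j, by simpa using hj, rfl⟩
        exact hf j _ (by omega)
  rw [normalCoeff, LinearMap.add_apply, e1, e2, add_zero]

/-- The normally ordered product `:(∂_z^m h(z) / m!) A(z):`. -/
def normalOrd : VertexOperator ℂ (Fock ι) :=
  VertexOperator.of_coeff (normalCoeff B h m A) (normalCoeff_bdd B h m A)


/-- The state-field correspondence `Y` of the lattice vertex algebra with Gram matrix `B` and
bimultiplicative function `bimult E`: the state
`b_{i_1} s^{-m_1-1} ⋯ b_{i_k} s^{-m_k-1} ⊗ e^α` is sent to the nested normally ordered product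
`:(∂^{m_1} b_{i_1}(z) / m_1!) ⋯ (∂^{m_k} b_{i_k}(z) / m_k!) E^α(z):`, and `Y` is linear. (The
order of the `k` factors is immaterial.) -/
def Y (E : ι → ι → ℤˣ) : Fock ι →ₗ[ℂ] VertexOperator ℂ (Fock ι) :=
  Finsupp.lsum ℂ fun α => (MvPolynomial.basisMonomials (ι × ℕ) ℂ).constr ℂ fun d =>
    (Finsupp.toMultiset d).toList.foldr (fun p F => normalOrd B (Pi.single p.1 1) p.2 F)
      (expField B E α)

/-- The mode `a_(m)`, defined by `Y(a, z) = ∑_m a_(m) z^{-m-1}`. -/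
def mode (E : ι → ι → ℤˣ) (a : Fock ι) (m : ℤ) : Module.End ℂ (Fock ι) :=
  VertexOperator.ncoeff (Y B E a) m

theorem mode_eventually (E : ι → ι → ℤˣ) (a v : Fock ι) :
    ∃ N : ℤ, ∀ m, N < m → mode B E a m v = 0 := by
  obtain ⟨N, hN⟩ := coeff_bdd (Y B E a) v
  exact ⟨-N, fun m hm => hN _ (by omega)⟩

theorem tensorMode_locFin (E : ι → ι → ℤˣ) (a b : Fock ι) (m : ℤ) :
    LocFin fun l : ℤ => TensorProduct.map (mode B E a l) (mode B E b (m - l - 1)) := by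
  intro w
  induction w using TensorProduct.induction_on with
  | zero => simp
  | add u v hu hv =>
    refine (hu.union hv).subset ?_
    simp only [map_add]
    exact Function.support_add _ _
  | tmul u v =>
    obtain ⟨M, hM⟩ := mode_eventually B E a u
    obtain ⟨N, hN⟩ := mode_eventually B E b v
    refine (Set.finite_Icc (m - 1 - N) M).subset fun l hl => ?_
    by_contra hlt
    refine hl ?_
    simp only [TensorProduct.map_tmul]
    by_cases h1 : M < l
    · rw [hM l h1, TensorProduct.zero_tmul]
    · rw [hN _ (by
        by_contra h2
        exact hlt ⟨by omega, by omega⟩), TensorProduct.tmul_zero]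

/-- The mode `(a ⊠ b)_(m)` on `V ⊗ V`, where `Y(a ⊠ b, z) = Y(a, z) ⊠ Y(b, z)`; that is,
`(a ⊠ b)_(m) = ∑_l a_(l) ⊠ b_(m-l-1)`. -/
def tensorMode (E : ι → ι → ℤˣ) (a b : Fock ι) (m : ℤ) : Module.End ℂ (Fock ι ⊗[ℂ] Fock ι) :=
  locSum _ (tensorMode_locFin B E a b m)

/-- The component of a vector of `V ⊗ V` in degree `(β, γ)`, with respect to the grading of
`V ⊗ V` by pairs of lattice vectors. -/
def component (β γ : ι → ℤ) : Fock ι ⊗[ℂ] Fock ι →ₗ[ℂ] Sym ι ⊗[ℂ] Sym ι :=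
  TensorProduct.map (Finsupp.lapply β) (Finsupp.lapply γ)

theorem mode_exp_single (E : ι → ι → ℤˣ) (α β γ : ι → ℤ) (g : Sym ι) (m : ℤ)
    (hne : α + β ≠ γ) : mode B E (Finsupp.single α 1) m (Finsupp.single β g) γ = 0 := by
  have h1 : Y B E (Finsupp.single α 1) = expField B E α := by
    have h2 : (1 : Sym ι) = MvPolynomial.basisMonomials (ι × ℕ) ℂ 0 := by simp
    rw [Y, Finsupp.lsum_single, h2, Module.Basis.constr_basis]
    simp
  rw [mode, h1, expField, VertexOperator.ncoeff_of_coeff]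
  simp [expFieldCoeff, Finsupp.single_eq_of_ne' hne]

end Fock

/-! ### The toroidal situation -/

section Toroidal

variable (ℓ r : ℕ)

/-- The index set of the basis `v_1, …, v_ℓ, θ_1, …, θ_r, Θ_1, …, Θ_r` of the lattice `Γ`. -/
abbrev Idx : Type := Fin ℓ ⊕ (Fin r ⊕ Fin r)

/-- The lattice `Γ = Q ⊕ R`. -/
abbrev Lattice : Type := Idx ℓ r → ℤ

variable {ℓ r}

/-- The basis vector `v_i`. -/
def v (i : Fin ℓ) : Lattice ℓ r := Pi.single (Sum.inl i) 1

/-- The basis vector `θ_ν`. -/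
def th (ν : Fin r) : Lattice ℓ r := Pi.single (Sum.inr (Sum.inl ν)) 1

/-- The vector `p · θ = ∑_ν p_ν θ_ν`. -/
def dotTh (p : Fin r → ℤ) : Lattice ℓ r := ∑ ν, p ν • th ν

variable (ℓ r) in
/-- The Gram matrix of `Γ`: `(v_i|v_j) = δ_ij`, `(θ_ν|Θ_μ) = (Θ_μ|θ_ν) = δ_νμ`, all other products
of basis vectors vanish. -/
def gram : Matrix (Idx ℓ r) (Idx ℓ r) ℤ
  | Sum.inl i, Sum.inl j => if i = j then 1 else 0
  | Sum.inr (Sum.inl ν), Sum.inr (Sum.inr μ) => if ν = μ then 1 else 0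
  | Sum.inr (Sum.inr μ), Sum.inr (Sum.inl ν) => if ν = μ then 1 else 0
  | _, _ => 0

/-- The signs `ε_ij = ε(v_i, v_j)`: `1` for `i < j` and `-1` for `i ≥ j`. -/
def epsQ (i j : Fin ℓ) : ℤˣ := if i < j then 1 else -1

variable (ℓ) in
/-- The values of `ε` on pairs of basis vectors; the values `ε(Θ_μ, θ_ν) = c μ ν` are arbitrary
signs. -/
def epsBasis (c : Fin r → Fin r → ℤˣ) : Idx ℓ r → Idx ℓ r → ℤˣ
  | Sum.inl i, Sum.inl j => epsQ i j
  | Sum.inr (Sum.inl ν), Sum.inr (Sum.inr μ) => if ν = μ then -1 else 1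
  | Sum.inr (Sum.inr μ), Sum.inr (Sum.inl ν) => c μ ν
  | _, _ => 1

/-- The mode `a_(m)` of a state `a` of the lattice vertex algebra `V_Γ`. -/
def torMode (c : Fin r → Fin r → ℤˣ) (a : Fock (Idx ℓ r)) (m : ℤ) :
    Module.End ℂ (Fock (Idx ℓ r)) :=
  mode (gram ℓ r) (epsBasis ℓ c) a m

/-- The operator `h_{i,m}^p`, the `m`-th mode of `(v_i - v_j) s^{-1} ⊗ e^{p·θ}` where
`j = i + 1`. -/
def hOp (c : Fin r → Fin r → ℤˣ) (i j : Fin ℓ) (p : Fin r → ℤ) (m : ℤ) :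
    Module.End ℂ (Fock (Idx ℓ r)) :=
  torMode c (Finsupp.single (dotTh p) (hs (toC (v i - v j)) 0)) m

/-- The operator `e_{kl,m}^p = ε_lk (1 ⊗ e^{v_k - v_l + p·θ})_(m)`. -/
def eOp (c : Fin r → Fin r → ℤˣ) (k l : Fin ℓ) (p : Fin r → ℤ) (m : ℤ) :
    Module.End ℂ (Fock (Idx ℓ r)) :=
  ((epsQ l k : ℤˣ) : ℤ) • torMode c (Finsupp.single (v k - v l + dotTh p) 1) m

variable (ℓ) in
/-- The operator `κ_{0,m}^p = (1 ⊗ e^{p·θ})_(m-1)`. -/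
def kapZeroOp (c : Fin r → Fin r → ℤˣ) (p : Fin r → ℤ) (m : ℤ) :
    Module.End ℂ (Fock (Idx ℓ r)) :=
  torMode c (Finsupp.single (dotTh p) 1) (m - 1)

variable (ℓ) in
/-- The operator `κ_{ν,m}^p = (θ_ν s^{-1} ⊗ e^{p·θ})_(m)`. -/
def kapOp (c : Fin r → Fin r → ℤˣ) (ν : Fin r) (p : Fin r → ℤ) (m : ℤ) :
    Module.End ℂ (Fock (Idx ℓ r)) :=
  torMode c (Finsupp.single (dotTh p) (hs (toC (th ν)) 0)) m

variable (ℓ) in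
/-- The Lie algebra `g^tor` of operators on `V_Γ` generated by the operators `h_{i,m}^p`,
`e_{kl,m}^p` and `κ_{ν,m}^p`. -/
def gTor (c : Fin r → Fin r → ℤˣ) : LieSubalgebra ℂ (Module.End ℂ (Fock (Idx ℓ r))) :=
  LieSubalgebra.lieSpan ℂ _
    ({x | ∃ i j : Fin ℓ, (i : ℕ) + 1 = j ∧ ∃ p m, x = hOp c i j p m} ∪
      {x | ∃ k l : Fin ℓ, k ≠ l ∧ ∃ p m, x = eOp c k l p m} ∪
      {x | ∃ p m, x = kapZeroOp ℓ c p m} ∪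
      {x | ∃ ν p m, x = kapOp ℓ c ν p m})

theorem omegaTor_locFin (c : Fin r → Fin r → ℤˣ) (m : ℤ) (k : Fin ℓ) (β γ : Lattice ℓ r) :
    LocFin fun q : Fin r → ℤ => component β γ ∘ₗ
      tensorMode (gram ℓ r) (epsBasis ℓ c) (Finsupp.single (v k + dotTh q) 1)
        (Finsupp.single (-v k - dotTh q) 1) m := by
  intro w
  induction w using TensorProduct.induction_on with
  | zero => simp
  | add u v hu hv =>
    refine (hu.union hv).subset ?_
    simp only [map_add]
    exact Function.support_add _ _
  | tmul x y =>
    induction x using Finsupp.induction_linear with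
    | zero => simp
    | add u v hu hv =>
      refine (hu.union hv).subset ?_
      simp only [TensorProduct.add_tmul, map_add]
      exact Function.support_add _ _
    | single α g =>
      refine (Set.finite_singleton
        (fun ν => (β - α) (Sum.inr (Sum.inl ν)) : Fin r → ℤ)).subset fun q hq => ?_
      by_contra hne
      refine hq ?_
      have h1 : v k + dotTh q + α ≠ β := by
        rintro rfl
        refine hne (funext fun ν => ?_)
        simp [v, dotTh, th, Finset.sum_apply, Pi.single_apply]
      change component β γ (∑ᶠ l, _) = 0
      rw [map_finsum _ (tensorMode_locFin _ _ _ _ _ _)]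
      refine finsum_eq_zero_of_forall_eq_zero fun l => ?_
      rw [TensorProduct.map_tmul, component, TensorProduct.map_tmul, Finsupp.lapply_apply,
        mode_exp_single _ _ _ _ _ _ _ h1, TensorProduct.zero_tmul]

/-- The mode `Ω^tor_(m)` of `Ω^tor = ∑_k ∑_{q ∈ ℤ^r} e^{v_k + q·θ} ⊠ e^{-v_k - q·θ}`. The sum over
`q` is infinite, and `Ω^tor_(m)` maps `V_Γ ⊗ V_Γ` to its completion, the product over all pairs
`(β, γ)` of lattice vectors of the components of degree `(β, γ)`; in each component only finitely
many `q` contribute. -/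
def omegaTor (c : Fin r → Fin r → ℤˣ) (m : ℤ) :
    (Fock (Idx ℓ r) ⊗[ℂ] Fock (Idx ℓ r)) →ₗ[ℂ]
      (Lattice ℓ r × Lattice ℓ r → Sym (Idx ℓ r) ⊗[ℂ] Sym (Idx ℓ r)) :=
  LinearMap.pi fun d => ∑ k : Fin ℓ, locSum _ (omegaTor_locFin c m k d.1 d.2)

/-- The term `X^n |0⟩ / n!` of the exponential series of `X` at the vacuum. -/
def expTermVac (X : Module.End ℂ (Fock (Idx ℓ r))) (n : ℕ) : Fock (Idx ℓ r) :=
  ((Nat.factorial n : ℂ))⁻¹ • (X ^ n) (vac (Idx ℓ r))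

/-- `Z = e^X |0⟩` in `V_Γ`: the series `∑_n X^n |0⟩ / n!` converges to `Z` in `V_Γ`, tested
against all linear functionals. -/
def IsExpVac (X : Module.End ℂ (Fock (Idx ℓ r))) (Z : Fock (Idx ℓ r)) : Prop :=
  ∀ f : Module.Dual ℂ (Fock (Idx ℓ r)), HasSum (fun n => f (expTermVac X n)) (f Z)

end Toroidal

end ToroidalVertex

end

/-!
The Casimir element `Ω = ∑_k ∑_q e^{v_k + q·θ} ⊠ e^{-v_k - q·θ}` is invariant under the toroidal Lie
algebra, and its modes `Ω_(m)`, `m ≥ 0`, annihilate `|0⟩ ⊗ |0⟩`. Hence they annihilate everything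
that is obtained from `|0⟩ ⊗ |0⟩` by the diagonal action of the Lie algebra, in particular every
coefficient of `e^{tX}|0⟩ ⊗ e^{tX}|0⟩ = e^{t (X ⊗ 1 + 1 ⊗ X)} (|0⟩ ⊗ |0⟩)`.

The operators whose diagonal action preserves the kernel of `Ω_(m)` form a Lie algebra
(`diagStabilizer`), so invariance only has to be checked for the generators. There it holds because
a generator acts on the fields `e^{v_k + q·θ}` by a matrix `x`, up to shifts of `q` and of the mode,
and on the fields `e^{-v_k - q·θ}` by the negative transpose (`IsLoopAction`): in the commutator
with `Ω_(m)` the two contributions cancel after a shift of the summation index `q`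
(`IsLoopAction.omegaTor_diag`). The generators `e_{kl}` act by matrix units, the modes of
`h s^{-1} ⊗ e^{p·θ}` with `h = v_i - v_j` or `h = θ_ν` by diagonal matrices, and the modes of
`e^{p·θ}` by zero.

These commutators are computed directly from the vertex operators. In a noncommutative algebra the
exponential of a power series with commuting coefficients is the solution of `x y' = (x f') y`; the
uniqueness of that solution gives the rule `exp f(x) exp g(w) = (1 - x w)^k exp g(w) exp f(x)` for
exponents with central commutator (`expCoeff_mul_expCoeff`). Hence `E^α(z) E^β(w)` is
`(z - w)^{(α|β)}`, expanded for `|z| > |w|`, times a normally ordered product that is symmetric in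
the two fields (`expProd_expProd`, `normalPair_comm`) and becomes `E^{α+β}(z)` at `w = z`
(`finsum_normalPair`). For `(α|β) = 0, 1` the two orders of multiplication agree, and for
`(α|β) = -1` they differ by a delta function. The fields `:h(z) E^{p·θ}(z):` are reduced to this by
`[h_(r), E^β(z)] = (h|β) z^r E^β(z)`.

If `e^X|0⟩` converges to `Z` against all functionals, then the terms of the series span a
finite-dimensional space (`finiteDimensional_span_of_weakSum`), its coordinates are absolutely
convergent series, and `Ω_(m)(Z ⊗ Z)` is the sum of the Cauchy product, whose terms vanish
(`apply_self_eq_zero_of_weakSum`).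
-/

noncomputable section

namespace ToroidalVertex

/-! ### Exponentials of power series over a noncommutative algebra -/

section ExpSeries

open PowerSeries Finset

variable {A : Type*} [Ring A] [Algebra ℂ A]

/-- The Euler operator `x d/dx` on power series over a possibly noncommutative algebra. -/
def euler : PowerSeries A →ₗ[ℂ] PowerSeries A where
  toFun f := PowerSeries.mk fun n => (n : ℂ) • coeff n f
  map_add' f g := by ext n; simp
  map_smul' c f := by
    ext n
    simp only [coeff_mk, RingHom.id_apply, PowerSeries.coeff_smul]
    exact smul_comm _ _ _

theorem coeff_euler (f : PowerSeries A) (n : ℕ) : coeff n (euler f) = (n : ℂ) • coeff n f := by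
  simp [euler]

theorem euler_mul (f g : PowerSeries A) : euler (f * g) = euler f * g + f * euler g := by
  ext n
  simp only [coeff_euler, map_add, coeff_mul, smul_sum, ← sum_add_distrib]
  refine sum_congr rfl fun p hp => ?_
  rw [← mem_antidiagonal.mp hp, smul_mul_assoc, mul_smul_comm, ← add_smul]
  push_cast
  rfl

theorem euler_C (a : A) : euler (C a) = 0 := by
  ext n
  rw [coeff_euler, coeff_C]
  split_ifs with h <;> simp [h]

/-- The equation `x y' = u y` with `u(0) = 0` determines `y` by its constant term. -/
theorem eq_of_euler_eq {u y z : PowerSeries A} (hu : coeff 0 u = 0) (hy : euler y = u * y)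
    (hz : euler z = u * z) (h0 : coeff 0 y = coeff 0 z) : y = z := by
  rw [← sub_eq_zero]
  have hw : euler (y - z) = u * (y - z) := by rw [map_sub, hy, hz, mul_sub]
  have hw0 : coeff 0 (y - z) = 0 := by rw [map_sub, h0, sub_self]
  generalize y - z = w at hw hw0
  ext n
  induction n using Nat.strong_induction_on with
  | _ n ih =>
    rcases Nat.eq_zero_or_pos n with rfl | hn
    · exact hw0
    have h := congrArg (coeff n) hw
    rw [coeff_euler, coeff_mul] at h
    have hs : ∑ p ∈ antidiagonal n, coeff p.1 u * coeff p.2 w = 0 := by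
      refine sum_eq_zero fun p hp => ?_
      have := mem_antidiagonal.mp hp
      rcases Nat.eq_zero_or_pos p.1 with h1 | h1
      · rw [h1, hu, zero_mul]
      · rw [ih p.2 (by omega), map_zero, mul_zero]
    rw [hs] at h
    exact (smul_eq_zero.mp h).resolve_left (by exact_mod_cast hn.ne')

theorem commute_of_coeff {f g : PowerSeries A}
    (h : ∀ a b, Commute (coeff a f) (coeff b g)) : Commute f g := by
  ext n
  rw [coeff_mul, coeff_mul, ← Finset.Nat.sum_antidiagonal_swap]
  exact sum_congr rfl fun p _ => h _ _

theorem euler_pow_succ {f : PowerSeries A} (h : Commute f (euler f)) (j : ℕ) :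
    euler (f ^ (j + 1)) = ((j : ℂ) + 1) • (euler f * f ^ j) := by
  induction j with
  | zero => simp
  | succ j ih =>
    rw [pow_succ, euler_mul, ih, smul_mul_assoc, mul_assoc, ← pow_succ,
      ((h.pow_left (j + 1)).eq)]
    push_cast
    rw [add_smul ((j : ℂ) + 1), one_smul]

theorem coeff_pow_of_lt {f : PowerSeries A} (h0 : coeff 0 f = 0) {j n : ℕ} (h : n < j) :
    coeff n (f ^ j) = 0 := by
  obtain ⟨g, rfl⟩ := (PowerSeries.X_dvd_iff (φ := f)).mpr (by simpa using h0)
  rw [(PowerSeries.commute_X g).symm.mul_pow, PowerSeries.coeff_X_pow_mul', if_neg (by omega)]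

/-- The exponential series `∑_n expCoeff f n x^n`. -/
def expSeries (f : PowerSeries A) : PowerSeries A := PowerSeries.mk (expCoeff f)

theorem coeff_expSeries (f : PowerSeries A) (n : ℕ) : coeff n (expSeries f) = expCoeff f n :=
  coeff_mk _ _

theorem expCoeff_zero {f : PowerSeries A} : expCoeff f 0 = 1 := by
  simp [expCoeff]

theorem expCoeff_eq_sum_range {f : PowerSeries A} (h0 : coeff 0 f = 0) {n N : ℕ} (h : n < N) :
    expCoeff f n = ∑ j ∈ range N, ((Nat.factorial j : ℂ))⁻¹ • coeff n (f ^ j) := by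
  refine sum_subset (range_subset_range.mpr h) fun j _ hj => ?_
  rw [coeff_pow_of_lt h0 (by simpa using hj), smul_zero]

/-- The exponential of a series with commuting coefficients solves `x y' = (x f') y`. -/
theorem euler_expSeries {f : PowerSeries A} (h0 : coeff 0 f = 0)
    (hf : ∀ a b, Commute (coeff a f) (coeff b f)) :
    euler (expSeries f) = euler f * expSeries f := by
  have hc : Commute f (euler f) := commute_of_coeff fun a b => by
    rw [coeff_euler]; exact (hf a b).smul_right _
  ext n
  have h1 : coeff n (euler f * expSeries f) =
      ∑ j ∈ range (n + 1), ((Nat.factorial j : ℂ))⁻¹ • coeff n (euler f * f ^ j) := by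
    simp only [coeff_mul, coeff_expSeries, smul_sum]
    rw [sum_comm]
    refine sum_congr rfl fun p hp => ?_
    have := mem_antidiagonal.mp hp
    rw [expCoeff_eq_sum_range h0 (show p.2 < n + 1 by omega), mul_sum]
    exact sum_congr rfl fun j _ => mul_smul_comm _ _ _
  rw [coeff_euler, coeff_expSeries, expCoeff_eq_sum_range h0 (show n < n + 1 + 1 by omega),
    sum_range_succ', h1, smul_add, smul_sum]
  have h2 : (n : ℂ) • ((Nat.factorial 0 : ℂ))⁻¹ • coeff n (f ^ 0) = 0 := by
    rw [pow_zero, coeff_one]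
    split_ifs with h <;> simp [h]
  rw [h2, add_zero]
  refine sum_congr rfl fun j _ => ?_
  have h3 : coeff n (euler (f ^ (j + 1))) = ((j : ℂ) + 1) • coeff n (euler f * f ^ j) := by
    rw [euler_pow_succ hc, PowerSeries.coeff_smul]
  rw [coeff_euler] at h3
  rw [smul_comm, h3, smul_smul, Nat.factorial_succ]
  congr 1
  have : ((j : ℂ) + 1) ≠ 0 := by exact_mod_cast Nat.succ_ne_zero j
  have : (Nat.factorial j : ℂ) ≠ 0 := by exact_mod_cast Nat.factorial_ne_zero j
  push_cast
  field_simp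

theorem commute_expCoeff {f : PowerSeries A} {c : A} (h : ∀ a, Commute c (coeff a f)) (n : ℕ) :
    Commute c (expCoeff f n) := by
  refine Commute.sum_right _ _ _ fun j _ => Commute.smul_right ?_ _
  have : Commute (C c) (f ^ j) := Commute.pow_right (commute_of_coeff fun a b => by
    rw [coeff_C]
    split_ifs
    · exact h b
    · exact Commute.zero_left _) j
  have h2 := congrArg (coeff n) this.eq
  rwa [coeff_C_mul, coeff_mul_C] at h2

theorem commute_expCoeff_expCoeff {f g : PowerSeries A}
    (h : ∀ a b, Commute (coeff a f) (coeff b g)) (m n : ℕ) :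
    Commute (expCoeff f m) (expCoeff g n) :=
  commute_expCoeff (fun a => (commute_expCoeff (fun b => (h b a).symm) m).symm) n

/-- `exp (f + g) = exp f exp g` if all coefficients commute. -/
theorem expCoeff_add {f g : PowerSeries A} (hf0 : coeff 0 f = 0) (hg0 : coeff 0 g = 0)
    (hf : ∀ a b, Commute (coeff a f) (coeff b f)) (hg : ∀ a b, Commute (coeff a g) (coeff b g))
    (hfg : ∀ a b, Commute (coeff a f) (coeff b g)) (n : ℕ) :
    expCoeff (f + g) n = ∑ p ∈ antidiagonal n, expCoeff f p.1 * expCoeff g p.2 := by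
  have key : expSeries (f + g) = expSeries f * expSeries g := by
    refine eq_of_euler_eq (u := euler (f + g)) ?_ (euler_expSeries ?_ ?_) ?_ ?_
    · rw [coeff_euler]; simp
    · rw [map_add, hf0, hg0, add_zero]
    · intro a b
      simp only [map_add]
      exact ((hf a b).add_left (hfg b a).symm).add_right ((hfg a b).add_left (hg a b))
    · have : Commute (expSeries f) (euler g) := commute_of_coeff fun a b => by
        rw [coeff_euler, coeff_expSeries]
        exact (commute_expCoeff (fun c => (hfg c b).symm) a).symm.smul_right _
      rw [euler_mul, euler_expSeries hf0 hf, euler_expSeries hg0 hg, ← mul_assoc (expSeries f),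
        this.eq, map_add, add_mul, mul_assoc, mul_assoc]
    · simp [coeff_mul, coeff_expSeries, expCoeff_zero]
  rw [← coeff_expSeries, key, coeff_mul]
  simp only [coeff_expSeries]

/-- If the commutator of `c` with the coefficient of `x^M` in `f` is a scalar `lam`, and `c`
commutes with the other coefficients, then `[c, exp f] = lam x^M exp f`. -/
theorem commutator_expCoeff {f : PowerSeries A} (h0 : coeff 0 f = 0)
    (hf : ∀ a b, Commute (coeff a f) (coeff b f)) {c : A} {M : ℕ} (lam : ℂ) (hM : M ≠ 0)
    (hc : ∀ a, c * coeff a f = coeff a f * c + if a = M then lam • 1 else 0) (n : ℕ) :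
    c * expCoeff f n = expCoeff f n * c + if M ≤ n then lam • expCoeff f (n - M) else 0 := by
  have hE := euler_expSeries h0 hf
  have hXc : Commute (X ^ M : PowerSeries A) (euler f) := (PowerSeries.commute_X_pow _ _).symm
  have hce : C c * euler f = euler f * C c + ((M : ℂ) * lam) • X ^ M := by
    ext a
    rw [coeff_C_mul, coeff_euler, map_add, coeff_mul_C, coeff_euler, PowerSeries.coeff_smul,
      coeff_X_pow, mul_smul_comm, hc a, smul_add, smul_mul_assoc]
    split_ifs with h
    · rw [h, mul_smul]
    · simp
  have hX : euler (X ^ M : PowerSeries A) = (M : ℂ) • X ^ M := by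
    ext a
    rw [coeff_euler, PowerSeries.coeff_smul, coeff_X_pow]
    split_ifs with h
    · rw [h]
    · simp
  have key : C c * expSeries f - lam • (X ^ M * expSeries f) = expSeries f * C c := by
    refine eq_of_euler_eq (u := euler f) (by rw [coeff_euler]; simp) ?_ ?_ ?_
    · have h1 : euler (X ^ M * expSeries f) =
          (M : ℂ) • (X ^ M * expSeries f) + euler f * (X ^ M * expSeries f) := by
        rw [euler_mul, hX, hE, ← mul_assoc, hXc.eq, smul_mul_assoc, mul_assoc]
      rw [map_sub, map_smul, h1, euler_mul, euler_C, hE, zero_mul, zero_add, ← mul_assoc, hce,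
        add_mul, smul_mul_assoc, mul_sub, mul_assoc, smul_add, smul_smul, mul_smul_comm,
        mul_comm lam]
      abel
    · rw [euler_mul, euler_C, hE, mul_zero, add_zero, mul_assoc]
    · rw [map_sub, PowerSeries.coeff_smul, coeff_C_mul, coeff_mul_C, coeff_expSeries,
        expCoeff_zero, coeff_X_pow_mul', if_neg (by omega), smul_zero, sub_zero, one_mul, mul_one]
  have h2 := congrArg (coeff n) key
  rw [map_sub, PowerSeries.coeff_smul, coeff_C_mul, coeff_mul_C, coeff_expSeries,
    coeff_X_pow_mul', coeff_expSeries] at h2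
  rw [← h2]
  split_ifs <;> simp

/-- Coefficients of `(1 - t)^k`, characterised by `i b_i = -k ∑_{j < i} b_j` and `b_0 = 1`. -/
def IsBinomSeq (k : ℂ) (b : ℕ → ℂ) : Prop :=
  b 0 = 1 ∧ ∀ i : ℕ, (i : ℂ) * b i = -k * ∑ j ∈ range i, b j

/-- The reordering of `exp f(x)` and `exp g(w)`, if the coefficients satisfy
`[g_a, exp f(x)] = (k / a) x^a exp f(x)`: the product `exp f(x) exp g(w)` is
`(1 - x w)^k exp g(w) exp f(x)`. -/
theorem expCoeff_mul_expCoeff {f g : PowerSeries A} (hg0 : coeff 0 g = 0)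
    (hg : ∀ a b, Commute (coeff a g) (coeff b g)) {k : ℂ} {b : ℕ → ℂ} (hb : IsBinomSeq k b)
    (hfg : ∀ a n : ℕ, a ≠ 0 → (a : ℂ) • (coeff a g * expCoeff f n) =
      (a : ℂ) • (expCoeff f n * coeff a g) + if a ≤ n then k • expCoeff f (n - a) else 0)
    (n m : ℕ) :
    expCoeff f n * expCoeff g m = ∑ i ∈ range (m + 1),
      b i • (expCoeff g (m - i) * if i ≤ n then expCoeff f (n - i) else 0) := by
  -- Power series in `w` with coefficients in the power series in `x`.
  set Q : PowerSeries A := expSeries f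
  set G : PowerSeries (PowerSeries A) := PowerSeries.map C (euler g)
  set P : PowerSeries (PowerSeries A) := PowerSeries.map C (expSeries g)
  set T : PowerSeries (PowerSeries A) := PowerSeries.mk fun a => if a = 0 then 0 else X ^ a
  set S : PowerSeries (PowerSeries A) := PowerSeries.mk fun a => b a • X ^ a
  have hPE : euler P = G * P := by
    have h1 : euler P = PowerSeries.map C (euler (expSeries g)) := by
      ext1 a
      simp only [P, coeff_euler, coeff_map]
      ext n
      rw [PowerSeries.coeff_smul, coeff_C, coeff_C]
      split_ifs <;> simp
    rw [h1, euler_expSeries hg0 hg, map_mul]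
  have hGQ : G * C Q = C Q * G + k • (T * C Q) := by
    ext1 a
    rw [coeff_mul_C, map_add, coeff_C_mul, PowerSeries.coeff_smul, coeff_mul_C]
    ext n
    simp only [G, T, Q, coeff_map, coeff_mk, coeff_C_mul, coeff_euler, coeff_mul_C, map_add,
      PowerSeries.coeff_smul, coeff_expSeries]
    rcases Nat.eq_zero_or_pos a with rfl | ha
    · simp
    · rw [if_neg ha.ne', coeff_X_pow_mul', coeff_expSeries, smul_mul_assoc, hfg a n ha.ne',
        mul_smul_comm]
      split_ifs <;> simp
  have hSE : euler S = -(k • (T * S)) := by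
    ext1 a
    rw [coeff_euler, map_neg, PowerSeries.coeff_smul, coeff_mul,
      ← Finset.Nat.sum_antidiagonal_swap, Finset.Nat.sum_antidiagonal_eq_sum_range_succ_mk,
      sum_range_succ]
    simp only [S, T, coeff_mk, Prod.swap, Nat.sub_self, if_true, zero_mul, add_zero]
    rw [smul_smul, hb.2 a, neg_mul, neg_smul, mul_smul, sum_smul]
    congr 2
    refine sum_congr rfl fun j hj => ?_
    have := mem_range.mp hj
    rw [if_neg (by omega), mul_smul_comm, ← pow_add]
    congr 2
    omega
  have hS : ∀ Y, Commute S Y := fun Y => commute_of_coeff fun i j => by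
    rw [coeff_mk]
    exact ((PowerSeries.commute_X_pow _ _).symm).smul_left _
  have hT : ∀ Y, Commute T Y := fun Y => commute_of_coeff fun i j => by
    rw [coeff_mk]
    split_ifs
    · exact Commute.zero_left _
    · exact (PowerSeries.commute_X_pow _ _).symm
  have hQG : C Q * G = (G - k • T) * C Q := by
    rw [sub_mul, hGQ, smul_mul_assoc, add_sub_cancel_right]
  have key : C Q * P = S * (P * C Q) := by
    refine eq_of_euler_eq (u := G - k • T) ?_ ?_ ?_ ?_
    · rw [map_sub, PowerSeries.coeff_smul]
      simp [G, T, euler]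
    · rw [euler_mul, euler_C, zero_mul, zero_add, hPE, ← mul_assoc, hQG, mul_assoc]
    · rw [euler_mul, hSE, euler_mul, euler_C, mul_zero, add_zero, hPE, sub_mul, neg_mul,
        smul_mul_assoc, smul_mul_assoc, mul_assoc T S, mul_assoc G, ← mul_assoc S G, (hS G).eq,
        mul_assoc G]
      abel
    · simp [coeff_mul, P, S, expSeries, expCoeff_zero, hb.1]
  have h2 := congrArg (fun y => coeff n (coeff m y)) key
  simp only [P, S, Q, coeff_C_mul, coeff_map, coeff_mul_C, coeff_expSeries] at h2
  rw [h2, coeff_mul, Finset.Nat.sum_antidiagonal_eq_sum_range_succ_mk, map_sum]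
  refine sum_congr rfl fun i _ => ?_
  simp only [coeff_mk, coeff_mul_C, coeff_map, coeff_expSeries, smul_mul_assoc,
    PowerSeries.coeff_smul, coeff_X_pow_mul', coeff_C_mul, mul_ite, mul_zero]

end ExpSeries

/-! ### Finite sums over infinite index sets -/

section Finsum

variable {I J M : Type*} [AddCommMonoid M]

theorem finsum_comp_of_injective {e : I → J} (he : Function.Injective e) {f : J → M}
    (hf : ∀ j, f j ≠ 0 → j ∈ Set.range e) : ∑ᶠ i, f (e i) = ∑ᶠ j, f j := by
  rw [← finsum_mem_range he, ← finsum_mem_univ f]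
  exact finsum_mem_inter_support_eq _ _ _ (by
    ext j
    simp only [Set.mem_inter_iff, Function.mem_support, Set.mem_univ, true_and]
    exact ⟨fun h => h.2, fun h => ⟨hf j h, h⟩⟩)

theorem finsum_comm_of_finite (f : I → J → M)
    (hf : (Function.support fun p : I × J => f p.1 p.2).Finite) :
    ∑ᶠ i, ∑ᶠ j, f i j = ∑ᶠ j, ∑ᶠ i, f i j := by
  rw [← finsum_curry (fun p : I × J => f p.1 p.2) hf,
    ← finsum_comp_equiv (Equiv.prodComm J I), finsum_curry]
  · rfl
  · exact (Set.Finite.preimage (Equiv.prodComm J I).injective.injOn hf)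

/-- A sum over `ℤ`, split into the parts over `j ≥ 0` and `j < 0`. -/
theorem finsum_int_eq_add (f : ℤ → M) (hf : (Function.support f).Finite) :
    ∑ᶠ j, f j = ∑ᶠ i : ℕ, f i + ∑ᶠ i : ℕ, f (-(i + 1)) := by
  have h1 : ∀ j, f j = (if 0 ≤ j then f j else 0) + if 0 ≤ j then 0 else f j := fun j => by
    split_ifs <;> simp
  have he : Function.Injective fun i : ℕ => -((i : ℤ) + 1) := fun a b hab => by
    simpa using hab
  rw [finsum_congr h1, finsum_add_distrib]
  · congr 1
    · rw [← finsum_comp_of_injective (Nat.cast_injective (R := ℤ))]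
      · exact finsum_congr fun i => if_pos (by omega)
      · intro j hj
        split_ifs at hj with h0
        · exact ⟨j.toNat, by omega⟩
        · exact absurd rfl hj
    · rw [← finsum_comp_of_injective he]
      · exact finsum_congr fun i => if_neg (by omega)
      · intro j hj
        split_ifs at hj with h0
        · exact absurd rfl hj
        · exact ⟨(-j - 1).toNat, by simp only; omega⟩
  · refine hf.subset fun j hj h0 => hj ?_
    simp only [h0, ite_self]
  · refine hf.subset fun j hj h0 => hj ?_
    simp only [h0, ite_self]

end Finsum

/-! ### Oscillators on the symmetric algebra -/

section Oscillators

open PowerSeries Finset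

variable {ι : Type} [Fintype ι] [DecidableEq ι] (B : Matrix ι ι ℤ)

theorem hForm_eq_sum (h h' : ι → ℂ) : hForm B h h' = ∑ i, hForm B h (Pi.single i 1) * h' i := by
  simp only [hForm, Pi.single_apply, mul_ite, mul_one, mul_zero, Finset.sum_ite_eq',
    Finset.mem_univ, if_true, Finset.sum_mul]
  exact Finset.sum_comm

theorem hForm_add_left (h h' k : ι → ℂ) : hForm B (h + h') k = hForm B h k + hForm B h' k := by
  simp only [hForm, Pi.add_apply, add_mul, Finset.sum_add_distrib]

theorem hForm_add_right (h k k' : ι → ℂ) : hForm B h (k + k') = hForm B h k + hForm B h k' := by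
  simp only [hForm, Pi.add_apply, mul_add, Finset.sum_add_distrib]

theorem hForm_toC (α β : ι → ℤ) : hForm B (toC α) (toC β) = latForm B α β := by
  simp [hForm, latForm, toC]

theorem latForm_add_left (α β γ : ι → ℤ) :
    latForm B (α + β) γ = latForm B α γ + latForm B β γ := by
  simp only [latForm, Pi.add_apply, add_mul, Finset.sum_add_distrib]

theorem latForm_add_right (α β γ : ι → ℤ) :
    latForm B α (β + γ) = latForm B α β + latForm B α γ := by
  simp only [latForm, Pi.add_apply, mul_add, Finset.sum_add_distrib]

theorem toC_add (α β : ι → ℤ) : toC (α + β) = toC α + toC β := by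
  ext i; simp [toC]

theorem creat_commute (h h' : ι → ℂ) (m n : ℕ) : Commute (creat h m) (creat h' n) := by
  refine LinearMap.ext fun g => ?_
  simp [creat, mul_left_comm]

theorem pderiv_pderiv_comm {σ : Type*} (i j : σ) (g : MvPolynomial σ ℂ) :
    MvPolynomial.pderiv i (MvPolynomial.pderiv j g) =
      MvPolynomial.pderiv j (MvPolynomial.pderiv i g) := by
  have h : ⁅MvPolynomial.pderiv (R := ℂ) i, MvPolynomial.pderiv (R := ℂ) j⁆ = 0 := by
    classical
    refine MvPolynomial.derivation_ext fun k => ?_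
    rw [Derivation.commutator_apply, MvPolynomial.pderiv_X, MvPolynomial.pderiv_X]
    simp only [Pi.single_apply]
    split_ifs <;> simp
  have h2 := DFunLike.congr_fun h g
  rwa [Derivation.commutator_apply, Derivation.coe_zero, Pi.zero_apply, sub_eq_zero] at h2

theorem annih_commute (h h' : ι → ℂ) (m n : ℕ) : Commute (annih B h m) (annih B h' n) := by
  refine Commute.sum_left _ _ _ fun i _ => Commute.sum_right _ _ _ fun j _ =>
    Commute.smul_left (Commute.smul_right ?_ _) _
  refine LinearMap.ext fun g => ?_
  exact pderiv_pderiv_comm _ _ _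

theorem annih_hs (h h' : ι → ℂ) (m n : ℕ) :
    annih B h m (hs h' n) =
      if m = n then MvPolynomial.C (((m : ℂ) + 1) * hForm B h h') else 0 := by
  have h1 : ∀ i, MvPolynomial.pderiv (i, m) (hs h' n) =
      if m = n then MvPolynomial.C (h' i) else 0 := by
    intro i
    simp only [hs, map_sum, MvPolynomial.pderiv_C_mul, MvPolynomial.pderiv_X, Pi.single_apply,
      Prod.mk.injEq]
    rw [sum_eq_single i]
    · by_cases hmn : m = n <;> simp [hmn, Ne.symm]
    · intro j _ hj
      simp [hj]
    · simp
  simp only [annih, LinearMap.sum_apply, LinearMap.smul_apply, Derivation.coeFn_coe, h1]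
  split_ifs
  · rw [hForm_eq_sum, mul_sum, map_sum]
    exact sum_congr rfl fun i _ => by
      rw [MvPolynomial.smul_eq_C_mul, ← map_mul, mul_assoc]
  · simp

theorem annih_creat (h h' : ι → ℂ) (m n : ℕ) :
    annih B h m * creat h' n = creat h' n * annih B h m +
      if m = n then (((m : ℂ) + 1) * hForm B h h') • 1 else 0 := by
  have hder : ∀ f g, annih B h m (f * g) = f * annih B h m g + annih B h m f * g := by
    intro f g
    simp only [annih, LinearMap.sum_apply, LinearMap.smul_apply, Derivation.coeFn_coe,
      Derivation.leibniz, smul_add, sum_add_distrib, mul_sum, sum_mul, smul_eq_mul]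
    congr 1
    · exact sum_congr rfl fun i _ => (mul_smul_comm _ _ _).symm
    · exact sum_congr rfl fun i _ => by rw [smul_mul_assoc, mul_comm g]
  refine LinearMap.ext fun g => ?_
  have h2 := hder (hs h' n) g
  rw [annih_hs] at h2
  simp only [creat, Module.End.mul_apply, LinearMap.add_apply, LinearMap.mulLeft_apply, h2]
  split_ifs
  · simp [MvPolynomial.smul_eq_C_mul]
  · simp

/-! ### Coefficients of the exponentials of oscillators -/

theorem coeff_plusExponent_zero (h : ι → ℂ) : coeff 0 (plusExponent h) = 0 := by
  simp [plusExponent]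

theorem coeff_minusExponent_zero (h : ι → ℂ) : coeff 0 (minusExponent B h) = 0 := by
  simp [minusExponent]

theorem coeff_plusExponent_succ (h : ι → ℂ) (n : ℕ) :
    coeff (n + 1) (plusExponent h) = ((n : ℂ) + 1)⁻¹ • creat h n := by
  simp [plusExponent]

theorem coeff_minusExponent_succ (h : ι → ℂ) (n : ℕ) :
    coeff (n + 1) (minusExponent B h) = (-((n : ℂ) + 1)⁻¹) • annih B h n := by
  simp [minusExponent]

theorem plusExponent_commute (h h' : ι → ℂ) (a b : ℕ) :
    Commute (coeff a (plusExponent h)) (coeff b (plusExponent h')) := by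
  rcases a with _ | a
  · rw [coeff_plusExponent_zero]; exact Commute.zero_left _
  rcases b with _ | b
  · rw [coeff_plusExponent_zero]; exact Commute.zero_right _
  rw [coeff_plusExponent_succ, coeff_plusExponent_succ]
  exact ((creat_commute _ _ _ _).smul_left _).smul_right _

theorem minusExponent_commute (h h' : ι → ℂ) (a b : ℕ) :
    Commute (coeff a (minusExponent B h)) (coeff b (minusExponent B h')) := by
  rcases a with _ | a
  · rw [coeff_minusExponent_zero]; exact Commute.zero_left _
  rcases b with _ | b
  · rw [coeff_minusExponent_zero]; exact Commute.zero_right _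
  rw [coeff_minusExponent_succ, coeff_minusExponent_succ]
  exact ((annih_commute _ _ _ _ _).smul_left _).smul_right _

theorem creat_add (h h' : ι → ℂ) (n : ℕ) : creat (h + h') n = creat h n + creat h' n := by
  refine LinearMap.ext fun g => ?_
  simp [creat, hs, add_mul, sum_add_distrib]

theorem annih_add (h h' : ι → ℂ) (n : ℕ) :
    annih B (h + h') n = annih B h n + annih B h' n := by
  simp only [annih, hForm_add_left, mul_add, add_smul, sum_add_distrib]

theorem plusExponent_add (h h' : ι → ℂ) :
    plusExponent (h + h') = plusExponent h + plusExponent h' := by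
  ext1 n
  rcases n with _ | n
  · simp [coeff_plusExponent_zero, -coeff_zero_eq_constantCoeff]
  · rw [map_add, coeff_plusExponent_succ, coeff_plusExponent_succ, coeff_plusExponent_succ,
      creat_add, smul_add]

theorem minusExponent_add (h h' : ι → ℂ) :
    minusExponent B (h + h') = minusExponent B h + minusExponent B h' := by
  ext1 n
  rcases n with _ | n
  · simp [coeff_minusExponent_zero, -coeff_zero_eq_constantCoeff]
  · rw [map_add, coeff_minusExponent_succ, coeff_minusExponent_succ, coeff_minusExponent_succ,
      annih_add, smul_add]

/-- The annihilating exponential `exp (- ∑_{n > 0} h_(n) x^n / n)` has the commutator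
`[h'_(-m-1), exp] = (h|h') x^{m+1} exp`. -/
theorem creat_mul_expCoeff_minus (h h' : ι → ℂ) (m n : ℕ) :
    creat h' m * expCoeff (minusExponent B h) n = expCoeff (minusExponent B h) n * creat h' m +
      if m + 1 ≤ n then hForm B h h' • expCoeff (minusExponent B h) (n - (m + 1)) else 0 := by
  refine commutator_expCoeff (coeff_minusExponent_zero B h) (minusExponent_commute B h h) _
    m.succ_ne_zero (fun a => ?_) n
  rcases a with _ | a
  · simp [coeff_minusExponent_zero, -coeff_zero_eq_constantCoeff]
  rw [coeff_minusExponent_succ, smul_mul_assoc, annih_creat, mul_smul_comm, smul_add, add_assoc,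
    left_eq_add]
  by_cases h1 : a = m
  · subst h1
    have : (a : ℂ) + 1 ≠ 0 := by exact_mod_cast a.succ_ne_zero
    rw [if_pos rfl, if_pos rfl, smul_smul, ← add_smul]
    field_simp
    simp
  · rw [if_neg h1, if_neg (by omega), smul_zero, add_zero]

theorem annih_mul_expCoeff_plus (h h' : ι → ℂ) (m n : ℕ) :
    annih B h' m * expCoeff (plusExponent h) n = expCoeff (plusExponent h) n * annih B h' m +
      if m + 1 ≤ n then hForm B h' h • expCoeff (plusExponent h) (n - (m + 1)) else 0 := by
  refine commutator_expCoeff (coeff_plusExponent_zero h) (plusExponent_commute h h) _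
    m.succ_ne_zero (fun a => ?_) n
  rcases a with _ | a
  · simp [coeff_plusExponent_zero, -coeff_zero_eq_constantCoeff]
  rw [coeff_plusExponent_succ, smul_mul_assoc, mul_smul_comm, annih_creat, smul_add]
  congr 1
  by_cases h1 : a = m
  · subst h1
    have : (a : ℂ) + 1 ≠ 0 := by exact_mod_cast a.succ_ne_zero
    rw [if_pos rfl, if_pos rfl, smul_smul]
    field_simp
  · rw [if_neg (Ne.symm h1), if_neg (by omega), smul_zero]

theorem expCoeff_minus_mul_plus (α β : ι → ℂ) {b : ℕ → ℂ}
    (hb : IsBinomSeq (hForm B α β) b) (n m : ℕ) :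
    expCoeff (minusExponent B α) n * expCoeff (plusExponent β) m = ∑ i ∈ range (m + 1),
      b i • (expCoeff (plusExponent β) (m - i) *
        if i ≤ n then expCoeff (minusExponent B α) (n - i) else 0) := by
  refine expCoeff_mul_expCoeff (coeff_plusExponent_zero β) (plusExponent_commute β β) hb
    (fun a n ha => ?_) n m
  obtain ⟨a, rfl⟩ := Nat.exists_eq_succ_of_ne_zero ha
  have : (a : ℂ) + 1 ≠ 0 := by exact_mod_cast a.succ_ne_zero
  rw [Nat.succ_eq_add_one, coeff_plusExponent_succ, smul_mul_assoc, creat_mul_expCoeff_minus,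
    mul_smul_comm, smul_add, smul_add]
  push_cast
  rw [smul_smul, smul_smul, mul_inv_cancel₀ this, one_smul, one_smul]

end Oscillators

/-! ### Products of exponentials on the symmetric algebra -/

section ExpProducts

variable {ι : Type} [Fintype ι] [DecidableEq ι] (B : Matrix ι ι ℤ)

/-- The coefficient of `z^a` in `exp (∑_{n > 0} h_(-n) z^n / n)`, for `a ∈ ℤ`. -/
def plusZ (h : ι → ℂ) (a : ℤ) : Module.End ℂ (Sym ι) :=
  if 0 ≤ a then expCoeff (plusExponent h) a.toNat else 0

/-- The coefficient of `z^{-b}` in `exp (∑_{n < 0} h_(-n) z^n / n)`, for `b ∈ ℤ`. -/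
def minusZ (h : ι → ℂ) (b : ℤ) : Module.End ℂ (Sym ι) :=
  if 0 ≤ b then expCoeff (minusExponent B h) b.toNat else 0

theorem plusZ_of_neg (h : ι → ℂ) {a : ℤ} (ha : a < 0) : plusZ h a = 0 :=
  if_neg (not_le.mpr ha)

theorem minusZ_of_neg (h : ι → ℂ) {b : ℤ} (hb : b < 0) : minusZ B h b = 0 :=
  if_neg (not_le.mpr hb)

theorem plusZ_natCast (h : ι → ℂ) (a : ℕ) : plusZ h a = expCoeff (plusExponent h) a := by
  simp [plusZ]

theorem minusZ_natCast (h : ι → ℂ) (b : ℕ) :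
    minusZ B h b = expCoeff (minusExponent B h) b := by
  simp [minusZ]

theorem plusZ_commute (h h' : ι → ℂ) (a b : ℤ) : Commute (plusZ h a) (plusZ h' b) := by
  unfold plusZ
  split_ifs
  · exact commute_expCoeff_expCoeff (plusExponent_commute h h') _ _
  all_goals first | exact Commute.zero_left _ | exact Commute.zero_right _

theorem minusZ_commute (h h' : ι → ℂ) (a b : ℤ) : Commute (minusZ B h a) (minusZ B h' b) := by
  unfold minusZ
  split_ifs
  · exact commute_expCoeff_expCoeff (minusExponent_commute B h h') _ _
  all_goals first | exact Commute.zero_left _ | exact Commute.zero_right _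

/-- The operators `minusZ B h b`, `b > N`, annihilate a given polynomial. -/
theorem exists_minusZ_zero (h : ι → ℂ) (g : Sym ι) :
    ∃ N : ℤ, ∀ b : ℤ, N < b → minusZ B h b g = 0 := by
  obtain ⟨N, hN⟩ := exists_expCoeff_zero B h g
  refine ⟨N, fun b hb => ?_⟩
  lift b to ℕ using by omega
  rw [minusZ_natCast, hN b (by omega)]

theorem finite_minusZ (h : ι → ℂ) (g : Sym ι) :
    (Function.support fun b : ℤ => minusZ B h b g).Finite := by
  obtain ⟨N, hN⟩ := exists_minusZ_zero B h g
  refine (Set.finite_Icc 0 N).subset fun b hb => ⟨?_, ?_⟩ <;> by_contra hlt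
  · exact hb (by simp [minusZ_of_neg B h (not_le.mp hlt)])
  · exact hb (hN b (not_le.mp hlt))

theorem exists_minusZ_minusZ_bound (h h' : ι → ℂ) (g : Sym ι) :
    ∃ N : ℤ, ∀ a b : ℤ, minusZ B h a (minusZ B h' b g) ≠ 0 → (0 ≤ a ∧ a ≤ N) ∧ 0 ≤ b ∧ b ≤ N := by
  obtain ⟨M, hM⟩ := exists_minusZ_zero B h g
  obtain ⟨N, hN⟩ := exists_minusZ_zero B h' g
  refine ⟨max M N, fun a b hab => ⟨⟨?_, ?_⟩, ?_, ?_⟩⟩ <;> by_contra hlt <;> refine hab ?_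
  · rw [minusZ_of_neg B h (not_le.mp hlt), LinearMap.zero_apply]
  · have h1 := LinearMap.congr_fun (minusZ_commute B h h' a b).eq g
    rw [Module.End.mul_apply, Module.End.mul_apply] at h1
    rw [h1, hM a (lt_of_le_of_lt (le_max_left M N) (not_le.mp hlt)), map_zero]
  · rw [minusZ_of_neg B h' (not_le.mp hlt), LinearMap.zero_apply, map_zero]
  · rw [hN b (lt_of_le_of_lt (le_max_right M N) (not_le.mp hlt)), map_zero]

theorem expProd_apply (h : ι → ℂ) (j : ℤ) (g : Sym ι) :
    expProd B h j g = ∑ᶠ b : ℤ, plusZ h (j + b) (minusZ B h b g) := by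
  have he : Function.Injective fun b : ℕ => ((j + b).toNat, b) := fun a b hab => by
    simpa using (congrArg Prod.snd hab)
  have h1 : expProd B h j g = ∑ᶠ p, expTerm B h j p g := rfl
  rw [h1, ← finsum_comp_of_injective he, ← finsum_comp_of_injective (Nat.cast_injective (R := ℤ))]
  · refine finsum_congr fun b => ?_
    rw [minusZ_natCast, expTerm, plusZ]
    by_cases hb : 0 ≤ j + b
    · rw [if_pos (by simp only; omega), if_pos hb]
      rfl
    · rw [if_neg (by simp only; omega), if_neg hb, LinearMap.zero_apply, LinearMap.zero_apply]
  · intro b hb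
    by_contra hlt
    have : b < 0 := by
      by_contra h0
      exact hlt ⟨b.toNat, by omega⟩
    exact hb (by rw [minusZ_of_neg B h this]; simp)
  · rintro ⟨a, b⟩ hab
    refine ⟨b, ?_⟩
    unfold expTerm at hab
    split_ifs at hab with h2
    · simp only at h2 ⊢
      rw [Prod.mk.injEq]
      omega
    · exact absurd rfl hab

/-- Convolution sums over `ℤ` of sequences supported in `ℕ`. -/
theorem finsum_convolution {P Q : ℤ → Module.End ℂ (Sym ι)} (hP : ∀ b < 0, P b = 0)
    (hQ : ∀ b < 0, Q b = 0) (c : ℕ) (g : Sym ι) :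
    ∑ᶠ b : ℤ, P b (Q (c - b) g) =
      (∑ p ∈ Finset.HasAntidiagonal.antidiagonal c, P p.1 * Q p.2) g := by
  rw [← finsum_comp_of_injective (Nat.cast_injective (R := ℤ)),
    finsum_eq_sum_of_support_subset (s := Finset.range (c + 1)),
    Finset.Nat.sum_antidiagonal_eq_sum_range_succ_mk, LinearMap.sum_apply]
  · refine Finset.sum_congr rfl fun b hb => ?_
    have := Finset.mem_range.mp hb
    rw [Module.End.mul_apply, Nat.cast_sub (by omega)]
  · intro b hb
    by_contra hlt
    rw [Finset.coe_range, Set.mem_Iio, not_lt] at hlt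
    exact hb (by simp only; rw [hQ _ (by omega), LinearMap.zero_apply, map_zero])
  · intro b hb
    by_contra hlt
    have : b < 0 := by
      by_contra h0
      exact hlt ⟨b.toNat, by omega⟩
    exact hb (by rw [hP b this, LinearMap.zero_apply])

/-- The coefficient form of `exp (f_α + f_β) = exp f_α exp f_β` for the creation parts. -/
theorem plusZ_add (α β : ι → ℂ) (u v : ℤ) (g : Sym ι) :
    ∑ᶠ j : ℤ, plusZ α (u + j) (plusZ β (v - j) g) = plusZ (α + β) (u + v) g := by
  rw [← finsum_comp_equiv (Equiv.subRight u)]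
  have h1 : ∀ j : ℤ, plusZ α (u + Equiv.subRight u j) (plusZ β (v - Equiv.subRight u j) g) =
      plusZ α j (plusZ β (u + v - j) g) := fun j => by
    rw [Equiv.subRight_apply, show u + (j - u) = j by ring, show v - (j - u) = u + v - j by ring]
  rw [finsum_congr h1]
  generalize u + v = c
  rcases lt_or_ge c 0 with hc | hc
  · rw [plusZ_of_neg _ hc, LinearMap.zero_apply]
    refine finsum_eq_zero_of_forall_eq_zero fun b => ?_
    rcases lt_or_ge b 0 with hb | hb
    · rw [plusZ_of_neg _ hb, LinearMap.zero_apply]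
    · rw [plusZ_of_neg β (by omega), LinearMap.zero_apply, map_zero]
  · lift c to ℕ using hc
    rw [finsum_convolution (fun b => plusZ_of_neg α) (fun b => plusZ_of_neg β), plusZ_natCast,
      plusExponent_add, expCoeff_add (coeff_plusExponent_zero α) (coeff_plusExponent_zero β)
        (plusExponent_commute α α) (plusExponent_commute β β) (plusExponent_commute α β)]
    simp only [plusZ_natCast]

theorem minusZ_add (α β : ι → ℂ) (c : ℤ) (g : Sym ι) :
    ∑ᶠ b : ℤ, minusZ B α b (minusZ B β (c - b) g) = minusZ B (α + β) c g := by
  rcases lt_or_ge c 0 with hc | hc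
  · rw [minusZ_of_neg _ _ hc, LinearMap.zero_apply]
    refine finsum_eq_zero_of_forall_eq_zero fun b => ?_
    rcases lt_or_ge b 0 with hb | hb
    · rw [minusZ_of_neg _ _ hb, LinearMap.zero_apply]
    · rw [minusZ_of_neg B β (by omega), LinearMap.zero_apply, map_zero]
  · lift c to ℕ using hc
    rw [finsum_convolution (fun b => minusZ_of_neg B α) (fun b => minusZ_of_neg B β),
      minusZ_natCast, minusExponent_add,
      expCoeff_add (coeff_minusExponent_zero B α) (coeff_minusExponent_zero B β)
        (minusExponent_commute B α α) (minusExponent_commute B β β) (minusExponent_commute B α β)]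
    simp only [minusZ_natCast]

theorem minusZ_plusZ (α β : ι → ℂ) {b : ℕ → ℂ} (hb : IsBinomSeq (hForm B α β) b) (n m : ℤ)
    (g : Sym ι) :
    minusZ B α n (plusZ β m g) =
      ∑ᶠ i : ℕ, b i • plusZ β (m - i) (minusZ B α (n - i) g) := by
  rcases lt_or_ge m 0 with hm | hm
  · rw [plusZ_of_neg _ hm, LinearMap.zero_apply, map_zero,
      finsum_eq_zero_of_forall_eq_zero fun i => ?_]
    rw [plusZ_of_neg β (by omega), LinearMap.zero_apply, smul_zero]
  rcases lt_or_ge n 0 with hn | hn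
  · rw [minusZ_of_neg _ _ hn, LinearMap.zero_apply,
      finsum_eq_zero_of_forall_eq_zero fun i => ?_]
    rw [minusZ_of_neg B α (by omega), LinearMap.zero_apply, map_zero, smul_zero]
  lift m to ℕ using hm
  lift n to ℕ using hn
  rw [minusZ_natCast, plusZ_natCast, ← Module.End.mul_apply, expCoeff_minus_mul_plus B α β hb,
    LinearMap.sum_apply, finsum_eq_sum_of_support_subset (s := Finset.range (m + 1))]
  · refine Finset.sum_congr rfl fun i hi => ?_
    have := Finset.mem_range.mp hi
    rw [LinearMap.smul_apply, Module.End.mul_apply, ← Nat.cast_sub (by omega), plusZ_natCast]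
    split_ifs with hin
    · rw [← Nat.cast_sub hin, minusZ_natCast]
    · rw [minusZ_of_neg B α (by omega)]
  · intro i hi
    by_contra hlt
    rw [Finset.coe_range, Set.mem_Iio, not_lt] at hlt
    exact hi (by
      simp only
      rw [plusZ_of_neg β (by omega), LinearMap.zero_apply, smul_zero])

/-- The coefficient of `z^s w^t` in the normally ordered product of the exponentials of `α` at `z`
and of `β` at `w`, with all creation operators to the left. -/
def normalPair (α β : ι → ℂ) (s t : ℤ) (g : Sym ι) : Sym ι :=
  ∑ᶠ p : ℤ × ℤ, plusZ α (s + p.1) (plusZ β (t + p.2) (minusZ B α p.1 (minusZ B β p.2 g)))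

theorem normalPair_comm (α β : ι → ℂ) (s t : ℤ) (g : Sym ι) :
    normalPair B α β s t g = normalPair B β α t s g := by
  rw [normalPair, normalPair, ← finsum_comp_equiv (Equiv.prodComm ℤ ℤ)]
  refine finsum_congr fun p => ?_
  have h1 := LinearMap.congr_fun (minusZ_commute B α β p.2 p.1).eq g
  have h2 := LinearMap.congr_fun (plusZ_commute α β (s + p.2) (t + p.1)).eq
    (minusZ B β p.1 (minusZ B α p.2 g))
  rw [Module.End.mul_apply, Module.End.mul_apply] at h1 h2
  rw [← h2, ← h1]
  rfl

theorem exists_normalPair_zero (α β : ι → ℂ) (g : Sym ι) :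
    ∃ N : ℤ, ∀ s t, s < N ∨ t < N → normalPair B α β s t g = 0 := by
  obtain ⟨N, hN⟩ := exists_minusZ_minusZ_bound B α β g
  refine ⟨-N, fun s t hst => finsum_eq_zero_of_forall_eq_zero fun p => ?_⟩
  by_cases h0 : minusZ B α p.1 (minusZ B β p.2 g) = 0
  · rw [h0, map_zero, map_zero]
  have h1 := hN _ _ h0
  rcases hst with h2 | h2
  · rw [plusZ_of_neg α (by omega), LinearMap.zero_apply]
  · rw [plusZ_of_neg β (by omega), LinearMap.zero_apply, map_zero]

/-- The product of exponential fields is `(1 - w / z)^{(α|β)}` times their normally ordered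
product. -/
theorem expProd_expProd (α β : ι → ℂ) {b : ℕ → ℂ} (hb : IsBinomSeq (hForm B α β) b) (s t : ℤ)
    (g : Sym ι) :
    expProd B α s (expProd B β t g) = ∑ᶠ i : ℕ, b i • normalPair B α β (s + i) (t - i) g := by
  let F : ℤ × ℤ × ℕ → Sym ι := fun p => b p.2.2 • plusZ α (s + p.1)
    (plusZ β (t + p.2.1 - p.2.2) (minusZ B α (p.1 - p.2.2) (minusZ B β p.2.1 g)))
  obtain ⟨N, hN⟩ := exists_minusZ_minusZ_bound B α β g
  have hF : (Function.support F).Finite := by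
    refine ((Set.finite_Icc 0 (N + (t + N))).prod
      ((Set.finite_Icc 0 N).prod (Set.finite_Iic (t + N).toNat))).subset ?_
    rintro ⟨x, y, i⟩ hp
    have h1 : minusZ B α (x - i) (minusZ B β y g) ≠ 0 := fun h0 => hp (by
      simp only [F]
      rw [h0, map_zero, map_zero, smul_zero])
    have h2 : 0 ≤ t + y - i := by
      by_contra hlt
      exact hp (by
        simp only [F]
        rw [plusZ_of_neg β (not_le.mp hlt), LinearMap.zero_apply, map_zero, smul_zero])
    have h3 := hN _ _ h1
    simp only [Set.mem_prod, Set.mem_Icc, Set.mem_Iic]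
    omega
  have e1 : expProd B α s (expProd B β t g) = ∑ᶠ p, F p := by
    rw [finsum_curry₃ _ hF, expProd_apply]
    refine finsum_congr fun x => ?_
    rw [expProd_apply, map_finsum, map_finsum]
    · refine finsum_congr fun y => ?_
      rw [minusZ_plusZ B α β hb, map_finsum]
      · exact finsum_congr fun i => map_smul _ _ _
      · refine (Set.finite_Iic (t + y).toNat).subset fun i hi => ?_
        by_contra hlt
        rw [Set.mem_Iic, not_le] at hlt
        exact hi (by
          simp only
          rw [plusZ_of_neg β (by omega), LinearMap.zero_apply, smul_zero])
    · refine (finite_minusZ B β g).subset fun y hy h0 => hy ?_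
      simp only at h0 ⊢
      rw [h0, map_zero, map_zero]
    · refine (finite_minusZ B β g).subset fun y hy h0 => hy ?_
      simp only at h0 ⊢
      rw [h0, map_zero]
  let e : ℕ × ℤ × ℤ → ℤ × ℤ × ℕ := fun p => (p.2.1 + p.1, p.2.2, p.1)
  have he : Function.Injective e := by
    rintro ⟨i, x, y⟩ ⟨i', x', y'⟩ h
    simp only [e, Prod.mk.injEq] at h ⊢
    omega
  rw [e1, ← finsum_comp_of_injective he, finsum_curry]
  · refine finsum_congr fun i => ?_
    rw [normalPair, smul_finsum]
    refine finsum_congr fun p => ?_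
    simp only [F, e]
    rw [add_sub_cancel_right, show s + (p.1 + (i : ℤ)) = s + i + p.1 by ring,
      show t + p.2 - (i : ℤ) = t - i + p.2 by ring]
  · exact Set.Finite.preimage he.injOn hF
  · rintro ⟨x, y, i⟩ _
    exact ⟨(i, x - i, y), by simp [e]⟩

/-- At `w = z` the normally ordered product is the exponential of `α + β`. -/
theorem finsum_normalPair (α β : ι → ℂ) (s t : ℤ) (g : Sym ι) :
    ∑ᶠ j : ℤ, normalPair B α β (s + j) (t - j) g = expProd B (α + β) (s + t) g := by
  obtain ⟨N, hN⟩ := exists_minusZ_minusZ_bound B α β g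
  simp only [normalPair]
  rw [finsum_comm_of_finite]
  · have h1 : ∀ p : ℤ × ℤ, ∑ᶠ j : ℤ, plusZ α (s + j + p.1)
        (plusZ β (t - j + p.2) (minusZ B α p.1 (minusZ B β p.2 g))) =
        plusZ (α + β) (s + t + (p.1 + p.2)) (minusZ B α p.1 (minusZ B β p.2 g)) := fun p => by
      rw [show s + t + (p.1 + p.2) = s + p.1 + (t + p.2) by ring, ← plusZ_add]
      refine finsum_congr fun j => ?_
      rw [show s + j + p.1 = s + p.1 + j by ring, show t - j + p.2 = t + p.2 - j by ring]
    rw [finsum_congr h1]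
    let e : ℤ × ℤ → ℤ × ℤ := fun p => (p.2, p.1 - p.2)
    have he : Function.Injective e := by
      rintro ⟨x, y⟩ ⟨x', y'⟩ h
      simp only [e, Prod.mk.injEq] at h ⊢
      omega
    rw [← finsum_comp_of_injective he, finsum_curry, expProd_apply]
    · refine finsum_congr fun c => ?_
      rw [← minusZ_add, map_finsum]
      · refine finsum_congr fun b => ?_
        simp only [e]
        rw [add_sub_cancel]
      · refine (Set.finite_Icc 0 N).subset fun b hb => ?_
        exact (hN _ _ hb).1
    · refine (((Set.finite_Icc 0 N).prod (Set.finite_Icc 0 N)).preimage he.injOn).subset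
        fun p hp => ?_
      exact hN _ _ fun h0 => hp (by simp only; rw [h0, map_zero])
    · rintro ⟨x, y⟩ _
      exact ⟨(x + y, x), by simp [e]⟩
  · refine ((Set.finite_Icc (-s - N) (t + N)).prod
      ((Set.finite_Icc 0 N).prod (Set.finite_Icc 0 N))).subset ?_
    rintro ⟨j, x, y⟩ hp
    have h1 := hN x y fun h0 => hp (by simp only; rw [h0, map_zero, map_zero])
    have h2 : 0 ≤ s + j + x := by
      by_contra hlt
      exact hp (by simp only; rw [plusZ_of_neg α (not_le.mp hlt), LinearMap.zero_apply])
    have h3 : 0 ≤ t - j + y := by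
      by_contra hlt
      exact hp (by simp only; rw [plusZ_of_neg β (not_le.mp hlt), LinearMap.zero_apply, map_zero])
    simp only [Set.mem_prod, Set.mem_Icc]
    omega

end ExpProducts

/-! ### Commutators of exponential fields -/

section ExpFields

theorem isBinomSeq_zero : IsBinomSeq 0 fun i => if i = 0 then 1 else 0 :=
  ⟨rfl, fun i => by rcases i with _ | i <;> simp⟩

theorem isBinomSeq_one : IsBinomSeq 1 fun i => if i = 0 then 1 else if i = 1 then -1 else 0 := by
  refine ⟨rfl, fun i => ?_⟩
  rcases i with _ | _ | i
  · simp
  · simp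
  · have h : ∑ j ∈ Finset.range (i + 1 + 1),
        (if j = 0 then (1 : ℂ) else if j = 1 then -1 else 0) = 0 := by
      rw [Finset.sum_range_succ', Finset.sum_range_succ']
      simp
    rw [h]
    simp

theorem isBinomSeq_neg_one : IsBinomSeq (-1) fun _ => 1 :=
  ⟨rfl, fun i => by simp⟩

variable {ι : Type} [Fintype ι] [DecidableEq ι] (B : Matrix ι ι ℤ) (E : ι → ι → ℤˣ)

theorem bimult_add_left (α β γ : ι → ℤ) :
    bimult E (α + β) γ = bimult E α γ * bimult E β γ := by
  simp only [bimult, Pi.add_apply, add_mul, zpow_add, Finset.prod_mul_distrib]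

theorem bimult_add_right (α β γ : ι → ℤ) :
    bimult E α (β + γ) = bimult E α β * bimult E α γ := by
  simp only [bimult, Pi.add_apply, mul_add, zpow_add, Finset.prod_mul_distrib]

/-- The value of `bimult E` as a complex number. -/
def sgn (α β : ι → ℤ) : ℂ := ((bimult E α β : ℤˣ) : ℤ)

theorem sgn_add_left (α β γ : ι → ℤ) : sgn E (α + β) γ = sgn E α γ * sgn E β γ := by
  simp [sgn, bimult_add_left]

theorem sgn_add_right (α β γ : ι → ℤ) : sgn E α (β + γ) = sgn E α β * sgn E α γ := by
  simp [sgn, bimult_add_right]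

theorem expFieldCoeff_single (α β : ι → ℤ) (n : ℤ) (g : Sym ι) :
    expFieldCoeff B E α n (Finsupp.single β g) =
      sgn E α β • Finsupp.single (α + β) (expProd B (toC α) (n - latForm B α β) g) := by
  simp [expFieldCoeff, sgn]

theorem expFieldCoeff_expFieldCoeff_single (α β γ : ι → ℤ) (n m : ℤ) (g : Sym ι) :
    expFieldCoeff B E α n (expFieldCoeff B E β m (Finsupp.single γ g)) =
      (sgn E α β * sgn E (α + β) γ) • Finsupp.single (α + β + γ)
        (expProd B (toC α) (n - latForm B α γ - latForm B α β)
          (expProd B (toC β) (m - latForm B β γ) g)) := by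
  rw [expFieldCoeff_single, map_smul, expFieldCoeff_single, smul_smul, sgn_add_right,
    latForm_add_right, sgn_add_left, add_assoc]
  congr 1
  · ring
  · rw [show n - (latForm B α β + latForm B α γ) = n - latForm B α γ - latForm B α β by ring]

theorem expProd_expProd_of_zero {α β : ι → ℤ} (h : latForm B α β = 0) (s t : ℤ) (g : Sym ι) :
    expProd B (toC α) s (expProd B (toC β) t g) = normalPair B (toC α) (toC β) s t g := by
  rw [expProd_expProd B (toC α) (toC β) (b := fun i => if i = 0 then 1 else 0)
    (by rw [hForm_toC, h, Int.cast_zero]; exact isBinomSeq_zero),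
    finsum_eq_single _ 0 fun i hi => by simp [hi]]
  simp

theorem expProd_expProd_of_one {α β : ι → ℤ} (h : latForm B α β = 1) (s t : ℤ) (g : Sym ι) :
    expProd B (toC α) s (expProd B (toC β) t g) = normalPair B (toC α) (toC β) s t g -
      normalPair B (toC α) (toC β) (s + 1) (t - 1) g := by
  rw [expProd_expProd B (toC α) (toC β)
    (b := fun i => if i = 0 then 1 else if i = 1 then -1 else 0)
    (by rw [hForm_toC, h, Int.cast_one]; exact isBinomSeq_one),
    finsum_eq_sum_of_support_subset (s := Finset.range 2), Finset.sum_range_succ,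
    Finset.sum_range_one]
  · simp [sub_eq_add_neg]
  · intro i hi
    by_contra hlt
    rw [Finset.coe_range, Set.mem_Iio, not_lt] at hlt
    exact hi (by simp only; rw [if_neg (by omega), if_neg (by omega), zero_smul])

theorem expProd_expProd_of_neg_one {α β : ι → ℤ} (h : latForm B α β = -1) (s t : ℤ) (g : Sym ι) :
    expProd B (toC α) s (expProd B (toC β) t g) =
      ∑ᶠ i : ℕ, normalPair B (toC α) (toC β) (s + i) (t - i) g := by
  rw [expProd_expProd B (toC α) (toC β) (b := fun _ => 1)
    (by rw [hForm_toC, h, Int.cast_neg, Int.cast_one]; exact isBinomSeq_neg_one)]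
  simp

theorem finite_normalPair (α β : ι → ℂ) (s t : ℤ) (g : Sym ι) :
    (Function.support fun j : ℤ => normalPair B α β (s + j) (t - j) g).Finite := by
  obtain ⟨N, hN⟩ := exists_normalPair_zero B α β g
  refine (Set.finite_Icc (N - s) (t - N)).subset fun j hj => ?_
  by_contra hlt
  rw [Set.mem_Icc] at hlt
  exact hj (hN _ _ (by omega))

/-- Exponential fields commute if `(α|β) = 0`. -/
theorem expFieldCoeff_commute_of_zero {α β : ι → ℤ} (h : latForm B α β = 0)
    (h' : latForm B β α = 0) (hs : sgn E α β = sgn E β α) (n m : ℤ) :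
    Commute (expFieldCoeff B E α n) (expFieldCoeff B E β m) := by
  refine Finsupp.lhom_ext fun γ g => ?_
  rw [Module.End.mul_apply, Module.End.mul_apply, expFieldCoeff_expFieldCoeff_single,
    expFieldCoeff_expFieldCoeff_single, h, h', sub_zero, sub_zero, expProd_expProd_of_zero B h,
    expProd_expProd_of_zero B h', normalPair_comm, hs, add_comm α β]

/-- Exponential fields of opposite signature commute if `(α|β) = 1`. -/
theorem expFieldCoeff_commute_of_one {α β : ι → ℤ} (h : latForm B α β = 1)
    (h' : latForm B β α = 1) (hs : sgn E α β = -sgn E β α) (n m : ℤ) :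
    Commute (expFieldCoeff B E α n) (expFieldCoeff B E β m) := by
  refine Finsupp.lhom_ext fun γ g => ?_
  rw [Module.End.mul_apply, Module.End.mul_apply, expFieldCoeff_expFieldCoeff_single,
    expFieldCoeff_expFieldCoeff_single, h, h', expProd_expProd_of_one B h,
    expProd_expProd_of_one B h', normalPair_comm B (toC β), normalPair_comm B (toC β), hs,
    add_comm α β, sub_add_cancel, sub_add_cancel, neg_mul, neg_smul, ← smul_neg,
    ← Finsupp.single_neg, neg_sub]

/-- The commutator of exponential fields with `(α|β) = -1`; both orders expand the same rational
function `(z - w)^{-1}`, and the difference of the expansions is the formal delta function. -/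
theorem expFieldCoeff_commutator_of_neg_one {α β : ι → ℤ} (h : latForm B α β = -1)
    (h' : latForm B β α = -1) (hs : sgn E α β = -sgn E β α) (n m : ℤ) :
    expFieldCoeff B E α n * expFieldCoeff B E β m -
      expFieldCoeff B E β m * expFieldCoeff B E α n =
      sgn E α β • expFieldCoeff B E (α + β) (n + m + 1) := by
  refine Finsupp.lhom_ext fun γ g => ?_
  rw [LinearMap.sub_apply, Module.End.mul_apply, Module.End.mul_apply,
    expFieldCoeff_expFieldCoeff_single, expFieldCoeff_expFieldCoeff_single, h, h',
    LinearMap.smul_apply, expFieldCoeff_single, smul_smul, latForm_add_left,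
    expProd_expProd_of_neg_one B h, expProd_expProd_of_neg_one B h']
  set s := n - latForm B α γ
  set t := m - latForm B β γ
  have hfin := finite_normalPair B (toC α) (toC β) (s + 1) t g
  have key : ∑ᶠ i : ℕ, normalPair B (toC α) (toC β) (s - -1 + i) (t - i) g +
      ∑ᶠ i : ℕ, normalPair B (toC β) (toC α) (t - -1 + i) (s - i) g =
      expProd B (toC (α + β)) (n + m + 1 - (latForm B α γ + latForm B β γ)) g := by
    rw [show n + m + 1 - (latForm B α γ + latForm B β γ) = s + 1 + t by simp only [s, t]; ring,
      toC_add, ← finsum_normalPair, finsum_int_eq_add _ hfin, sub_neg_eq_add, sub_neg_eq_add]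
    congr 1
    refine finsum_congr fun i => ?_
    rw [normalPair_comm, show s + 1 + -((i : ℤ) + 1) = s - i by ring,
      show t - -((i : ℤ) + 1) = t + 1 + i by ring]
  rw [← key, Finsupp.single_add, smul_add, add_comm β α, hs, neg_mul, neg_smul, neg_smul,
    sub_eq_add_neg]

/-- For `(α|β) = 0` the product `E^α(z) E^β(z)` is well defined and equals `ε(α, β) E^{α+β}(z)`. -/
theorem finsum_expFieldCoeff_mul {α β : ι → ℤ} (h : latForm B α β = 0) (n m : ℤ) (v : Fock ι) :
    (Function.support fun j : ℤ =>
      expFieldCoeff B E α (n + j) (expFieldCoeff B E β (m - j) v)).Finite ∧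
    ∑ᶠ j : ℤ, expFieldCoeff B E α (n + j) (expFieldCoeff B E β (m - j) v) =
      sgn E α β • expFieldCoeff B E (α + β) (n + m) v := by
  induction v using Finsupp.induction_linear with
  | zero => simp
  | add u v hu hv =>
    simp only [map_add, smul_add]
    exact ⟨(hu.1.union hv.1).subset (Function.support_add _ _), by
      rw [finsum_add_distrib hu.1 hv.1, hu.2, hv.2]⟩
  | single γ g =>
    have h1 : ∀ j : ℤ,
        expFieldCoeff B E α (n + j) (expFieldCoeff B E β (m - j) (Finsupp.single γ g)) =
        ((sgn E α β * sgn E (α + β) γ) • Finsupp.lsingle (R := ℂ) (α + β + γ))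
          (normalPair B (toC α) (toC β) (n - latForm B α γ + j) (m - latForm B β γ - j) g) :=
      fun j => by
        rw [expFieldCoeff_expFieldCoeff_single, h, expProd_expProd_of_zero B h,
          LinearMap.smul_apply, Finsupp.lsingle_apply,
          show n + j - latForm B α γ - 0 = n - latForm B α γ + j by ring,
          show m - j - latForm B β γ = m - latForm B β γ - j by ring]
    have hfin := finite_normalPair B (toC α) (toC β) (n - latForm B α γ) (m - latForm B β γ) g
    simp only [h1]
    refine ⟨hfin.subset fun j hj h0 => hj ?_, ?_⟩
    · simp only at h0 ⊢
      rw [h0, map_zero]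
    · rw [← map_finsum _ hfin, finsum_normalPair, expFieldCoeff_single, LinearMap.smul_apply,
        Finsupp.lsingle_apply, smul_smul, latForm_add_left, toC_add,
        show n - latForm B α γ + (m - latForm B β γ) =
          n + m - (latForm B α γ + latForm B β γ) by ring]

end ExpFields

/-! ### Commutators of Heisenberg operators with exponential fields -/

section HeisenbergFields

variable {ι : Type} [Fintype ι] [DecidableEq ι] (B : Matrix ι ι ℤ) (E : ι → ι → ℤˣ)

theorem hForm_comm {B : Matrix ι ι ℤ} (hB : B.IsSymm) (h k : ι → ℂ) :
    hForm B h k = hForm B k h := by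
  rw [hForm, Finset.sum_comm, hForm]
  refine Finset.sum_congr rfl fun i _ => Finset.sum_congr rfl fun j _ => ?_
  rw [hB.apply i j]
  ring

theorem annih_minusZ (h h' : ι → ℂ) (m : ℕ) (b : ℤ) :
    Commute (annih B h' m) (minusZ B h b) := by
  unfold minusZ
  split_ifs
  · refine commute_expCoeff (fun a => ?_) _
    rcases a with _ | a
    · rw [coeff_minusExponent_zero]; exact Commute.zero_right _
    · rw [coeff_minusExponent_succ]; exact (annih_commute _ _ _ _ _).smul_right _
  · exact Commute.zero_right _

theorem creat_plusZ (h h' : ι → ℂ) (m : ℕ) (a : ℤ) : Commute (creat h' m) (plusZ h a) := by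
  unfold plusZ
  split_ifs
  · refine commute_expCoeff (fun a => ?_) _
    rcases a with _ | a
    · rw [coeff_plusExponent_zero]; exact Commute.zero_right _
    · rw [coeff_plusExponent_succ]; exact (creat_commute _ _ _ _).smul_right _
  · exact Commute.zero_right _

theorem annih_plusZ (h h' : ι → ℂ) (m : ℕ) (a : ℤ) :
    annih B h' m * plusZ h a =
      plusZ h a * annih B h' m + hForm B h' h • plusZ h (a - (m + 1)) := by
  rcases lt_or_ge a 0 with ha | ha
  · rw [plusZ_of_neg h ha, plusZ_of_neg h (by omega)]
    simp
  lift a to ℕ using ha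
  rw [plusZ_natCast, annih_mul_expCoeff_plus]
  congr 1
  split_ifs with hm
  · rw [← plusZ_natCast]
    push_cast [hm]
    rfl
  · rw [plusZ_of_neg h (by omega), smul_zero]

theorem creat_minusZ (h h' : ι → ℂ) (m : ℕ) (b : ℤ) :
    creat h' m * minusZ B h b =
      minusZ B h b * creat h' m + hForm B h h' • minusZ B h (b - (m + 1)) := by
  rcases lt_or_ge b 0 with ha | ha
  · rw [minusZ_of_neg B h ha, minusZ_of_neg B h (by omega)]
    simp
  lift b to ℕ using ha
  rw [minusZ_natCast, creat_mul_expCoeff_minus]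
  congr 1
  split_ifs with hm
  · rw [← minusZ_natCast]
    push_cast [hm]
    rfl
  · rw [minusZ_of_neg B h (by omega), smul_zero]

theorem finite_map_minusZ (h : ι → ℂ) (g : Sym ι) (F : ℤ → Module.End ℂ (Sym ι)) :
    (Function.support fun b : ℤ => F b (minusZ B h b g)).Finite :=
  (finite_minusZ B h g).subset fun b hb h0 => hb (by simp only at h0 ⊢; rw [h0, map_zero])

theorem annih_expProd (h h' : ι → ℂ) (m : ℕ) (j : ℤ) (g : Sym ι) :
    annih B h' m (expProd B h j g) =
      expProd B h j (annih B h' m g) + hForm B h' h • expProd B h (j - (m + 1)) g := by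
  rw [expProd_apply, expProd_apply, expProd_apply, map_finsum _ (finite_map_minusZ B h g _),
    smul_finsum, ← finsum_add_distrib (finite_map_minusZ B h _ _)]
  · refine finsum_congr fun b => ?_
    have h1 := LinearMap.congr_fun (annih_plusZ B h h' m (j + b)) (minusZ B h b g)
    have h2 := LinearMap.congr_fun (annih_minusZ B h h' m b).eq g
    simp only [Module.End.mul_apply, LinearMap.add_apply, LinearMap.smul_apply] at h1 h2
    rw [h1, h2, show j + b - (m + 1) = j - (m + 1) + b by ring]
  · exact finite_map_minusZ B h g fun b => hForm B h' h • plusZ h (j - (m + 1) + b)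

theorem creat_expProd (h h' : ι → ℂ) (m : ℕ) (j : ℤ) (g : Sym ι) :
    creat h' m (expProd B h j g) =
      expProd B h j (creat h' m g) + hForm B h h' • expProd B h (j + (m + 1)) g := by
  have e : ∑ᶠ b : ℤ, plusZ h (j + (m + 1) + b) (minusZ B h b g) =
      ∑ᶠ b : ℤ, plusZ h (j + b) (minusZ B h (b - (m + 1)) g) := by
    rw [← finsum_comp_equiv (Equiv.subRight ((m : ℤ) + 1))]
    refine finsum_congr fun b => ?_
    rw [Equiv.subRight_apply, show j + (m + 1) + (b - ((m : ℤ) + 1)) = j + b by ring]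
  rw [expProd_apply, expProd_apply, expProd_apply, map_finsum _ (finite_map_minusZ B h g _), e,
    smul_finsum, ← finsum_add_distrib (finite_map_minusZ B h _ _)]
  · refine finsum_congr fun b => ?_
    have h1 := LinearMap.congr_fun (creat_minusZ B h h' m b) g
    have h2 := LinearMap.congr_fun (creat_plusZ h h' m (j + b)).eq (minusZ B h b g)
    simp only [Module.End.mul_apply, LinearMap.add_apply, LinearMap.smul_apply] at h1 h2
    rw [h2, h1, map_add, map_smul]
  · refine ((finite_minusZ B h g).preimage
      (Equiv.subRight ((m : ℤ) + 1)).injective.injOn).subset fun b hb h0 => hb ?_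
    simp only [Equiv.subRight_apply] at h0 ⊢
    rw [h0, map_zero, smul_zero]

/-- The commutation relation `[h_(r), E^β(z)] = (h|β) z^r E^β(z)`. -/
theorem heis_mul_expFieldCoeff {B : Matrix ι ι ℤ} (hB : B.IsSymm) (h : ι → ℂ) (β : ι → ℤ)
    (r m : ℤ) :
    heis B h r * expFieldCoeff B E β m =
      expFieldCoeff B E β m * heis B h r + hForm B h (toC β) • expFieldCoeff B E β (m - r) := by
  refine Finsupp.lhom_ext fun γ g => ?_
  rw [LinearMap.add_apply, Module.End.mul_apply, Module.End.mul_apply, LinearMap.smul_apply,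
    expFieldCoeff_single, expFieldCoeff_single, map_smul]
  match r with
  | Int.ofNat 0 =>
    have h0 : ∀ (δ : ι → ℤ) (x : Sym ι), heis B h (Int.ofNat 0) (Finsupp.single δ x) =
        hForm B h (toC δ) • Finsupp.single δ x := fun δ x => by simp [heis]
    rw [h0, h0, map_smul, expFieldCoeff_single, toC_add, hForm_add_right]
    simp only [Int.ofNat_eq_natCast, Nat.cast_zero, sub_zero]
    module
  | Int.ofNat (k + 1) =>
    have h0 : ∀ (δ : ι → ℤ) (x : Sym ι), heis B h (Int.ofNat (k + 1)) (Finsupp.single δ x) =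
        Finsupp.single δ (annih B h k x) := fun δ x => by simp [heis]
    rw [h0, h0, expFieldCoeff_single, annih_expProd, Finsupp.single_add, ← Finsupp.smul_single,
      smul_add, smul_comm (sgn E β γ), Int.ofNat_eq_natCast, sub_right_comm]
    push_cast
    rfl
  | Int.negSucc k =>
    have h0 : ∀ (δ : ι → ℤ) (x : Sym ι), heis B h (Int.negSucc k) (Finsupp.single δ x) =
        Finsupp.single δ (creat h k x) := fun δ x => by simp [heis]
    rw [h0, h0, expFieldCoeff_single, creat_expProd, Finsupp.single_add, ← Finsupp.smul_single,
      smul_add, smul_comm (sgn E β γ), hForm_comm hB h, Int.negSucc_eq, sub_neg_eq_add,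
      show m + ((k : ℤ) + 1) - latForm B β γ = m - latForm B β γ + (k + 1) by ring]

theorem divDeriv_zero (h : ι → ℂ) (j : ℤ) : divDeriv B h 0 j = heis B h (-j - 1) := by
  simp [divDeriv]

/-- The commutator of `:h(z) A(z):` with a field `M` that commutes with `A` and is an eigenvector
of the Heisenberg operators of `h`. -/
theorem normalCoeff_commutator (h : ι → ℂ) (A : VertexOperator ℂ (Fock ι))
    (M : ℤ → Module.End ℂ (Fock ι)) (lam : ℂ)
    (hA : ∀ n m, Commute (HVertexOperator.coeff A n) (M m))
    (hh : ∀ r m, heis B h r * M m = M m * heis B h r + lam • M (m - r)) (n m : ℤ) (v : Fock ι)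
    (hfin : (Function.support fun j : ℤ =>
      M (m + 1 + j) (HVertexOperator.coeff A (n - j) v)).Finite) :
    normalCoeff B h 0 A n (M m v) = M m (normalCoeff B h 0 A n v) +
      lam • ∑ᶠ j : ℤ, M (m + 1 + j) (HVertexOperator.coeff A (n - j) v) := by
  have hn : ∀ u, normalCoeff B h 0 A n u =
      ∑ᶠ j : ℕ, divDeriv B h 0 j (HVertexOperator.coeff A (n - j) u) +
      ∑ᶠ j : ℕ, HVertexOperator.coeff A (n + (j + 1)) (divDeriv B h 0 (-(j + 1)) u) :=
    fun _ => rfl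
  have hA' : ∀ n m u, HVertexOperator.coeff A n (M m u) = M m (HVertexOperator.coeff A n u) :=
    fun n m u => LinearMap.congr_fun (hA n m).eq u
  have hh' : ∀ r m u, heis B h r (M m u) = M m (heis B h r u) + lam • M (m - r) u :=
    fun r m u => LinearMap.congr_fun (hh r m) u
  have f1 := normalPlus_locFin B h 0 A n v
  have f2 := normalMinus_locFin B h 0 A n v
  simp only [LinearMap.comp_apply] at f1 f2
  have g1 : (Function.support fun j : ℕ =>
      M (m + 1 + j) (HVertexOperator.coeff A (n - j) v)).Finite :=
    hfin.preimage Nat.cast_injective.injOn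
  have g2 : (Function.support fun j : ℕ =>
      M (m + 1 + -((j : ℤ) + 1)) (HVertexOperator.coeff A (n - -((j : ℤ) + 1)) v)).Finite :=
    hfin.preimage (f := fun j : ℕ => -((j : ℤ) + 1)) (fun a _ b _ hab => by simpa using hab)
  have f1' : (Function.support fun j : ℕ =>
      M m (divDeriv B h 0 j (HVertexOperator.coeff A (n - j) v))).Finite :=
    f1.subset fun j hj h0 => hj (by simp only at h0 ⊢; rw [h0, map_zero])
  have f2' : (Function.support fun j : ℕ =>
      M m (HVertexOperator.coeff A (n + (j + 1)) (divDeriv B h 0 (-(j + 1)) v))).Finite :=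
    f2.subset fun j hj h0 => hj (by simp only at h0 ⊢; rw [h0, map_zero])
  have g1' : (Function.support fun j : ℕ =>
      lam • M (m + 1 + j) (HVertexOperator.coeff A (n - j) v)).Finite :=
    g1.subset fun j hj h0 => hj (by simp only at h0 ⊢; rw [h0, smul_zero])
  have g2' : (Function.support fun j : ℕ => lam •
      M (m + 1 + -((j : ℤ) + 1)) (HVertexOperator.coeff A (n - -((j : ℤ) + 1)) v)).Finite :=
    g2.subset fun j hj h0 => hj (by simp only at h0 ⊢; rw [h0, smul_zero])
  rw [hn, hn, finsum_int_eq_add _ hfin, map_add, map_finsum _ f1, map_finsum _ f2, smul_add,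
    smul_finsum, smul_finsum, add_add_add_comm, ← finsum_add_distrib f1' g1',
    ← finsum_add_distrib f2' g2']
  congr 1
  · refine finsum_congr fun j => ?_
    rw [hA', divDeriv_zero, hh', show m - (-(j : ℤ) - 1) = m + 1 + j by ring]
  · refine finsum_congr fun j => ?_
    rw [divDeriv_zero, hh', map_add, map_smul, hA', hA',
      show m - (-(-((j : ℤ) + 1)) - 1) = m + 1 + -((j : ℤ) + 1) by ring,
      show n - -((j : ℤ) + 1) = n + (j + 1) by ring]

/-! ### Modes of the generating states -/

theorem coeff_expField (α : ι → ℤ) (n : ℤ) :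
    HVertexOperator.coeff (expField B E α) n = expFieldCoeff B E α n := by
  rw [expField, VertexOperator.of_coeff, HVertexOperator.coeff_of_coeff]

theorem mode_single_one (α : ι → ℤ) (m : ℤ) :
    mode B E (Finsupp.single α 1) m = expFieldCoeff B E α (-m - 1) := by
  have h1 : Y B E (Finsupp.single α 1) = expField B E α := by
    have h2 : (1 : Sym ι) = MvPolynomial.basisMonomials (ι × ℕ) ℂ 0 := by simp
    rw [Y, Finsupp.lsum_single, h2, Module.Basis.constr_basis]
    simp
  rw [mode, h1, expField, VertexOperator.ncoeff_of_coeff]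

theorem mode_single_hs (α : ι → ℤ) (h : ι → ℂ) (m : ℤ) :
    mode B E (Finsupp.single α (hs h 0)) m =
      ∑ i, h i • normalCoeff B (Pi.single i 1) 0 (expField B E α) (-m - 1) := by
  have h1 : ∀ i, Y B E (Finsupp.single α (MvPolynomial.X (i, 0))) =
      normalOrd B (Pi.single i 1) 0 (expField B E α) := fun i => by
    have h2 : (MvPolynomial.X (i, 0) : Sym ι) =
        MvPolynomial.basisMonomials (ι × ℕ) ℂ (Finsupp.single (i, 0) 1) := by
      simp [MvPolynomial.X]
    rw [Y, Finsupp.lsum_single, h2, Module.Basis.constr_basis]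
    simp
  have h3 : (Finsupp.single α (hs h 0) : Fock ι) =
      ∑ i, h i • Finsupp.single α (MvPolynomial.X (i, 0)) := by
    simp only [hs, Finsupp.smul_single, MvPolynomial.smul_eq_C_mul, Finsupp.single_finsetSum]
  rw [mode, h3, map_sum, map_sum, Finset.sum_apply]
  refine Finset.sum_congr rfl fun i _ => ?_
  rw [map_smul, map_smul, Pi.smul_apply, h1, normalOrd, VertexOperator.ncoeff_of_coeff]

/-- `[(h s^{-1} ⊗ e^α)_(n), (e^β)_(m)] = (h|β) ε(β, α) (e^{β+α})_(n+m)` if `(α|β) = 0` and the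
exponential fields of `α` and `β` commute. -/
theorem mode_hs_commutator {B : Matrix ι ι ℤ} (hB : B.IsSymm) (h : ι → ℂ) {α β : ι → ℤ}
    (hαβ : latForm B α β = 0) (hβα : latForm B β α = 0) (hs' : sgn E α β = sgn E β α) (n m : ℤ) :
    mode B E (Finsupp.single α (hs h 0)) n * mode B E (Finsupp.single β 1) m -
      mode B E (Finsupp.single β 1) m * mode B E (Finsupp.single α (hs h 0)) n =
      (hForm B h (toC β) * sgn E β α) • mode B E (Finsupp.single (β + α) 1) (n + m) := by
  simp only [mode_single_hs, mode_single_one]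
  refine LinearMap.ext fun v => ?_
  obtain ⟨hfin, hsum⟩ := finsum_expFieldCoeff_mul B E hβα (-m - 1 + 1) (-n - 1) v
  have key : ∀ i, normalCoeff B (Pi.single i 1) 0 (expField B E α) (-n - 1)
      (expFieldCoeff B E β (-m - 1) v) = expFieldCoeff B E β (-m - 1)
        (normalCoeff B (Pi.single i 1) 0 (expField B E α) (-n - 1) v) +
      hForm B (Pi.single i 1) (toC β) • sgn E β α •
        expFieldCoeff B E (β + α) (-(n + m) - 1) v := fun i => by
    have h1 := normalCoeff_commutator B (Pi.single i 1) (expField B E α) (expFieldCoeff B E β)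
      (hForm B (Pi.single i 1) (toC β))
      (fun n m => by rw [coeff_expField]; exact expFieldCoeff_commute_of_zero B E hαβ hβα hs' n m)
      (fun r m => heis_mul_expFieldCoeff E hB _ β r m) (-n - 1) (-m - 1) v
      (by simpa only [coeff_expField] using hfin)
    simp only [coeff_expField] at h1
    rw [h1, hsum, show -m - 1 + 1 + (-n - 1) = -(n + m) - 1 by ring]
  have hsum' : hForm B h (toC β) = ∑ i, h i * hForm B (Pi.single i 1) (toC β) := by
    rw [hForm_comm hB, hForm_eq_sum]
    exact Finset.sum_congr rfl fun i _ => by rw [hForm_comm hB (toC β), mul_comm]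
  simp only [LinearMap.sub_apply, Module.End.mul_apply, LinearMap.sum_apply,
    LinearMap.smul_apply, key, map_sum, map_smul, smul_add, Finset.sum_add_distrib,
    add_sub_cancel_left]
  rw [hsum', mul_smul, Finset.sum_smul]
  exact Finset.sum_congr rfl fun i _ => by rw [mul_smul]

end HeisenbergFields

/-! ### Operators acting on `V ⊗ V` -/

section TensorOperators

variable {ι : Type} [Fintype ι] [DecidableEq ι] (B : Matrix ι ι ℤ) (E : ι → ι → ℤˣ)

/-- If `[X, a_(l)] = ∑_i y_i (a'_i)_(n+l)` for all `l`, then `X ⊗ 1` has the commutator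
`∑_i y_i (a'_i ⊠ b)_(n+m)` with `(a ⊠ b)_(m)`. -/
theorem rTensor_tensorMode {κ : Type*} [Fintype κ] (X : Module.End ℂ (Fock ι)) (a b : Fock ι)
    (y : κ → ℂ) (a' : κ → Fock ι) (n : ℤ)
    (hX : ∀ l, X * mode B E a l - mode B E a l * X = ∑ i, y i • mode B E (a' i) (n + l)) (m : ℤ)
    (w : Fock ι ⊗[ℂ] Fock ι) :
    X.rTensor (Fock ι) (tensorMode B E a b m w) =
      tensorMode B E a b m (X.rTensor (Fock ι) w) +
        ∑ i, y i • tensorMode B E (a' i) b (n + m) w := by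
  have hT : ∀ a b m u, tensorMode B E a b m u =
      ∑ᶠ l : ℤ, TensorProduct.map (mode B E a l) (mode B E b (m - l - 1)) u := fun _ _ _ _ => rfl
  have hfin := tensorMode_locFin B E
  have hc : ∀ l k, X.rTensor (Fock ι) ∘ₗ TensorProduct.map (mode B E a l) (mode B E b k) =
      TensorProduct.map (mode B E a l) (mode B E b k) ∘ₗ X.rTensor (Fock ι) +
        ∑ i, y i • TensorProduct.map (mode B E (a' i) (n + l)) (mode B E b k) := fun l k => by
    refine TensorProduct.ext' fun u v => ?_
    have h1 := LinearMap.congr_fun (hX l) u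
    simp only [LinearMap.sub_apply, Module.End.mul_apply, LinearMap.sum_apply,
      LinearMap.smul_apply, sub_eq_iff_eq_add'] at h1
    simp only [LinearMap.comp_apply, TensorProduct.map_tmul, LinearMap.rTensor_tmul, h1,
      LinearMap.add_apply, LinearMap.sum_apply, LinearMap.smul_apply, TensorProduct.add_tmul,
      TensorProduct.sum_tmul, TensorProduct.smul_tmul']
  have hs : ∀ i, y i • tensorMode B E (a' i) b (n + m) w = ∑ᶠ l : ℤ,
      y i • TensorProduct.map (mode B E (a' i) (n + l)) (mode B E b (m - l - 1)) w := fun i => by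
    rw [hT, smul_finsum' _ (hfin (a' i) b (n + m) w), ← finsum_comp_equiv (Equiv.addLeft n)]
    refine finsum_congr fun l => ?_
    simp only [Equiv.coe_addLeft, show n + m - (n + l) - 1 = m - l - 1 by ring]
  have hs' : ∀ i, (Function.support fun l : ℤ =>
      y i • TensorProduct.map (mode B E (a' i) (n + l)) (mode B E b (m - l - 1)) w).Finite :=
    fun i => by
      refine ((hfin (a' i) b (n + m) w).preimage
        (Equiv.addLeft n).injective.injOn).subset fun l hl h0 => hl ?_
      simp only [Equiv.coe_addLeft, show n + m - (n + l) - 1 = m - l - 1 by ring] at h0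
      simp only [h0, smul_zero]
  rw [hT, hT, map_finsum _ (hfin a b m w), Finset.sum_congr rfl fun i _ => hs i,
    ← finsum_sum_comm _ _ fun i _ => hs' i, ← finsum_add_distrib (hfin a b m _)]
  · refine finsum_congr fun l => ?_
    have h1 := LinearMap.congr_fun (hc l (m - l - 1)) w
    simpa only [LinearMap.comp_apply, LinearMap.add_apply, LinearMap.sum_apply,
      LinearMap.smul_apply] using h1
  · refine (Set.finite_iUnion hs').subset fun l hl => ?_
    obtain ⟨i, _, hi⟩ := Finset.exists_ne_zero_of_sum_ne_zero hl
    exact Set.mem_iUnion.mpr ⟨i, hi⟩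

/-- The counterpart of `rTensor_tensorMode` for the operator `1 ⊗ X`. -/
theorem lTensor_tensorMode {κ : Type*} [Fintype κ] (X : Module.End ℂ (Fock ι)) (a b : Fock ι)
    (y : κ → ℂ) (b' : κ → Fock ι) (n : ℤ)
    (hX : ∀ l, X * mode B E b l - mode B E b l * X = ∑ i, y i • mode B E (b' i) (n + l)) (m : ℤ)
    (w : Fock ι ⊗[ℂ] Fock ι) :
    X.lTensor (Fock ι) (tensorMode B E a b m w) =
      tensorMode B E a b m (X.lTensor (Fock ι) w) +
        ∑ i, y i • tensorMode B E a (b' i) (n + m) w := by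
  have hT : ∀ a b m u, tensorMode B E a b m u =
      ∑ᶠ l : ℤ, TensorProduct.map (mode B E a l) (mode B E b (m - l - 1)) u := fun _ _ _ _ => rfl
  have hfin := tensorMode_locFin B E
  have hc : ∀ l k, X.lTensor (Fock ι) ∘ₗ TensorProduct.map (mode B E a l) (mode B E b k) =
      TensorProduct.map (mode B E a l) (mode B E b k) ∘ₗ X.lTensor (Fock ι) +
        ∑ i, y i • TensorProduct.map (mode B E a l) (mode B E (b' i) (n + k)) := fun l k => by
    refine TensorProduct.ext' fun u v => ?_
    have h1 := LinearMap.congr_fun (hX k) v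
    simp only [LinearMap.sub_apply, Module.End.mul_apply, LinearMap.sum_apply,
      LinearMap.smul_apply, sub_eq_iff_eq_add'] at h1
    simp only [LinearMap.comp_apply, TensorProduct.map_tmul, LinearMap.lTensor_tmul, h1,
      LinearMap.add_apply, LinearMap.sum_apply, LinearMap.smul_apply, TensorProduct.tmul_add,
      TensorProduct.tmul_sum, TensorProduct.tmul_smul]
  have hs : ∀ i, y i • tensorMode B E a (b' i) (n + m) w = ∑ᶠ l : ℤ,
      y i • TensorProduct.map (mode B E a l) (mode B E (b' i) (n + (m - l - 1))) w := fun i => by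
    rw [hT, smul_finsum' _ (hfin a (b' i) (n + m) w)]
    refine finsum_congr fun l => ?_
    simp only [show n + m - l - 1 = n + (m - l - 1) by ring]
  have hs' : ∀ i, (Function.support fun l : ℤ =>
      y i • TensorProduct.map (mode B E a l) (mode B E (b' i) (n + (m - l - 1))) w).Finite :=
    fun i => by
      refine (hfin a (b' i) (n + m) w).subset fun l hl h0 => hl ?_
      simp only [show n + m - l - 1 = n + (m - l - 1) by ring] at h0
      simp only [h0, smul_zero]
  rw [hT, hT, map_finsum _ (hfin a b m w), Finset.sum_congr rfl fun i _ => hs i,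
    ← finsum_sum_comm _ _ fun i _ => hs' i, ← finsum_add_distrib (hfin a b m _)]
  · refine finsum_congr fun l => ?_
    have h1 := LinearMap.congr_fun (hc l (m - l - 1)) w
    simpa only [LinearMap.comp_apply, LinearMap.add_apply, LinearMap.sum_apply,
      LinearMap.smul_apply] using h1
  · refine (Set.finite_iUnion hs').subset fun l hl => ?_
    obtain ⟨i, _, hi⟩ := Finset.exists_ne_zero_of_sum_ne_zero hl
    exact Set.mem_iUnion.mpr ⟨i, hi⟩

/-- Operators on the state space that raise the lattice degree by `δ`. -/
def IsHomog (δ : ι → ℤ) (X : Module.End ℂ (Fock ι)) : Prop :=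
  ∀ β g, X (Finsupp.single β g) ∈ LinearMap.range (Finsupp.lsingle (R := ℂ) (M := Sym ι) (β + δ))

/-- The part of an operator of degree `δ` that contributes to the degree `β`. -/
def homogPart (δ : ι → ℤ) (X : Module.End ℂ (Fock ι)) (β : ι → ℤ) : Module.End ℂ (Sym ι) :=
  Finsupp.lapply β ∘ₗ X ∘ₗ Finsupp.lsingle (β - δ)

theorem IsHomog.lapply_comp {δ : ι → ℤ} {X : Module.End ℂ (Fock ι)} (hX : IsHomog δ X)
    (β : ι → ℤ) : Finsupp.lapply β ∘ₗ X = homogPart δ X β ∘ₗ Finsupp.lapply (β - δ) := by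
  refine Finsupp.lhom_ext fun γ g => ?_
  obtain ⟨g', hg'⟩ := hX γ g
  simp only [LinearMap.comp_apply, homogPart, Finsupp.lapply_apply, Finsupp.lsingle_apply]
  by_cases h : γ = β - δ
  · rw [h, Finsupp.single_eq_same]
  · rw [Finsupp.single_eq_of_ne' h, Finsupp.single_zero, map_zero, ← hg', Finsupp.lsingle_apply,
      Finsupp.single_eq_of_ne' fun h1 => h (by rw [← h1, add_sub_cancel_right]),
      Finsupp.zero_apply]

theorem IsHomog.component_rTensor {δ : ι → ℤ} {X : Module.End ℂ (Fock ι)} (hX : IsHomog δ X)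
    (β γ : ι → ℤ) (w : Fock ι ⊗[ℂ] Fock ι) :
    component β γ (X.rTensor (Fock ι) w) =
      (homogPart δ X β).rTensor (Sym ι) (component (β - δ) γ w) := by
  rw [component, component, LinearMap.rTensor, LinearMap.rTensor, ← LinearMap.comp_apply,
    ← LinearMap.comp_apply, ← TensorProduct.map_comp, ← TensorProduct.map_comp, hX.lapply_comp,
    LinearMap.comp_id, LinearMap.id_comp]

theorem IsHomog.component_lTensor {δ : ι → ℤ} {X : Module.End ℂ (Fock ι)} (hX : IsHomog δ X)
    (β γ : ι → ℤ) (w : Fock ι ⊗[ℂ] Fock ι) :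
    component β γ (X.lTensor (Fock ι) w) =
      (homogPart δ X γ).lTensor (Sym ι) (component β (γ - δ) w) := by
  rw [component, component, LinearMap.lTensor, LinearMap.lTensor, ← LinearMap.comp_apply,
    ← LinearMap.comp_apply, ← TensorProduct.map_comp, ← TensorProduct.map_comp, hX.lapply_comp,
    LinearMap.comp_id, LinearMap.id_comp]

theorem IsHomog.smul {δ : ι → ℤ} {X : Module.End ℂ (Fock ι)} (hX : IsHomog δ X) (z : ℂ) :
    IsHomog δ (z • X) := fun β g => Submodule.smul_mem _ z (hX β g)

theorem IsHomog.add {δ : ι → ℤ} {X X' : Module.End ℂ (Fock ι)} (hX : IsHomog δ X)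
    (hX' : IsHomog δ X') : IsHomog δ (X + X') := fun β g => Submodule.add_mem _ (hX β g) (hX' β g)

theorem IsHomog.sum {κ : Type*} [Fintype κ] {δ : ι → ℤ} {X : κ → Module.End ℂ (Fock ι)}
    (hX : ∀ i, IsHomog δ (X i)) : IsHomog δ (∑ i, X i) := fun β g => by
  rw [LinearMap.sum_apply]
  exact Submodule.sum_mem _ fun i _ => hX i β g

theorem IsHomog.comp {δ δ' : ι → ℤ} {X X' : Module.End ℂ (Fock ι)} (hX : IsHomog δ X)
    (hX' : IsHomog δ' X') : IsHomog (δ' + δ) (X ∘ₗ X') := fun β g => by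
  obtain ⟨g', hg'⟩ := hX' β g
  rw [LinearMap.comp_apply, ← hg', ← add_assoc]
  exact hX _ _

theorem isHomog_locSum {κ : Type*} {δ : ι → ℤ} {F : κ → Module.End ℂ (Fock ι)} (hF : LocFin F)
    (h : ∀ i, IsHomog δ (F i)) : IsHomog δ (locSum F hF) := fun β g =>
  finsum_induction (fun x => x ∈ LinearMap.range (Finsupp.lsingle (R := ℂ) (β + δ)))
    (Submodule.zero_mem _) (fun _ _ => Submodule.add_mem _) fun i => h i β g

theorem isHomog_expFieldCoeff (α : ι → ℤ) (n : ℤ) : IsHomog α (expFieldCoeff B E α n) :=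
  fun β g => by
    rw [expFieldCoeff_single, add_comm α β]
    exact Submodule.smul_mem _ _ ⟨_, rfl⟩

theorem isHomog_heis (h : ι → ℂ) (n : ℤ) : IsHomog 0 (heis B h n) := fun β g => by
  rw [add_zero]
  match n with
  | Int.ofNat 0 => exact ⟨hForm B h (toC β) • g, by simp [heis]⟩
  | Int.ofNat (n + 1) => exact ⟨annih B h n g, by simp [heis]⟩
  | Int.negSucc n => exact ⟨creat h n g, by simp [heis]⟩

theorem isHomog_mode_single_one (α : ι → ℤ) (m : ℤ) :
    IsHomog α (mode B E (Finsupp.single α 1) m) := by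
  rw [mode_single_one]
  exact isHomog_expFieldCoeff B E α _

theorem isHomog_mode_single_hs (α : ι → ℤ) (h : ι → ℂ) (m : ℤ) :
    IsHomog α (mode B E (Finsupp.single α (hs h 0)) m) := by
  rw [mode_single_hs]
  refine IsHomog.sum fun i => IsHomog.smul (IsHomog.add ?_ ?_) _ <;>
    refine isHomog_locSum _ fun j => ?_ <;> rw [divDeriv_zero, coeff_expField]
  · simpa using (isHomog_heis B (Pi.single i 1) _).comp (isHomog_expFieldCoeff B E α _)
  · simpa using (isHomog_expFieldCoeff B E α _).comp (isHomog_heis B (Pi.single i 1) _)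

/-- Non-negative modes of exponential states annihilate the vacuum. -/
theorem mode_single_one_vac (α : ι → ℤ) {m : ℤ} (hm : 0 ≤ m) :
    mode B E (Finsupp.single α 1) m (vac ι) = 0 := by
  have hwt : HasWt 0 (1 : Sym ι) := fun d hd => by
    rw [MvPolynomial.coeff_one] at hd
    split_ifs at hd with h
    · rw [← h]; simp [wt]
    · exact absurd rfl hd
  have h0 : expProd B (toC α) (-m - 1) 1 = 0 := by
    rw [expProd_apply]
    refine finsum_eq_zero_of_forall_eq_zero fun b => ?_
    rcases lt_trichotomy b 0 with hb | rfl | hb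
    · rw [minusZ_of_neg B _ hb, LinearMap.zero_apply, map_zero]
    · rw [plusZ_of_neg _ (by omega), LinearMap.zero_apply]
    · lift b to ℕ using hb.le
      rw [minusZ_natCast, (expCoeff_mem B (toC α) b _ _ hwt).eq_zero (by omega), map_zero]
  have h1 : latForm B α 0 = 0 := by simp [latForm]
  rw [mode_single_one, vac, expFieldCoeff_single, h1, sub_zero, h0, Finsupp.single_zero, smul_zero]

theorem tensorMode_vac (α β : ι → ℤ) {m : ℤ} (hm : 0 ≤ m) :
    tensorMode B E (Finsupp.single α 1) (Finsupp.single β 1) m (vac ι ⊗ₜ vac ι) = 0 := by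
  refine finsum_eq_zero_of_forall_eq_zero fun l => ?_
  rw [TensorProduct.map_tmul]
  rcases lt_or_ge l 0 with hl | hl
  · rw [mode_single_one_vac B E β (by omega), TensorProduct.tmul_zero]
  · rw [mode_single_one_vac B E α hl, TensorProduct.zero_tmul]

end TensorOperators

/-! ### Operators commuting with the Casimir field -/

section Casimir

variable {ℓ r : ℕ} (c : Fin r → Fin r → ℤˣ)

/-- The state `e^{v_k + q·θ}`. -/
def psi (k : Fin ℓ) (q : Fin r → ℤ) : Fock (Idx ℓ r) := Finsupp.single (v k + dotTh q) 1

/-- The state `e^{-v_k - q·θ}`. -/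
def psiStar (k : Fin ℓ) (q : Fin r → ℤ) : Fock (Idx ℓ r) := Finsupp.single (-v k - dotTh q) 1

/-- The diagonal action of an operator on `V ⊗ V`. -/
def diag (X : Module.End ℂ (Fock (Idx ℓ r))) :
    Module.End ℂ (Fock (Idx ℓ r) ⊗[ℂ] Fock (Idx ℓ r)) :=
  X.rTensor _ + X.lTensor _

/-- A homogeneous operator acts as a loop if its commutators with the fields `e^{v_k + q·θ}` and
`e^{-v_k - q·θ}` are given by a matrix `x` and its negative transpose, up to a shift of `q` by `p`
and of the mode by `n`. This is how `x z^n e^{p·θ}` in the multiloop algebra of `gl_ℓ` acts on its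
vector representation and on the dual. -/
def IsLoopAction (X : Module.End ℂ (Fock (Idx ℓ r))) : Prop :=
  ∃ (δ : Lattice ℓ r) (x : Fin ℓ → Fin ℓ → ℂ) (p : Fin r → ℤ) (n : ℤ), IsHomog δ X ∧
    (∀ k q l, X * torMode c (psi k q) l - torMode c (psi k q) l * X =
      ∑ i, x i k • torMode c (psi i (p + q)) (n + l)) ∧
    ∀ k q l, X * torMode c (psiStar k q) l - torMode c (psiStar k q) l * X =
      ∑ i, (-x k i) • torMode c (psiStar i (q - p)) (n + l)

theorem finite_component_tensorMode (k : Fin ℓ) (b : (Fin r → ℤ) → Fock (Idx ℓ r)) (m : ℤ)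
    (β γ : Lattice ℓ r) (w : Fock (Idx ℓ r) ⊗[ℂ] Fock (Idx ℓ r)) :
    (Function.support fun q => component β γ
      (tensorMode (gram ℓ r) (epsBasis ℓ c) (psi k q) (b q) m w)).Finite := by
  induction w using TensorProduct.induction_on with
  | zero => simp
  | add u v hu hv =>
    refine (hu.union hv).subset ?_
    simp only [map_add]
    exact Function.support_add _ _
  | tmul x y =>
    induction x using Finsupp.induction_linear with
    | zero => simp
    | add u v hu hv =>
      refine (hu.union hv).subset ?_
      simp only [TensorProduct.add_tmul, map_add]
      exact Function.support_add _ _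
    | single α g =>
      refine (Set.finite_singleton
        (fun ν => (β - α) (Sum.inr (Sum.inl ν)) : Fin r → ℤ)).subset fun q hq => ?_
      by_contra hne
      refine hq ?_
      have h1 : v k + dotTh q + α ≠ β := by
        rintro rfl
        refine hne (funext fun ν => ?_)
        simp [v, dotTh, th, Finset.sum_apply, Pi.single_apply]
      change component β γ (∑ᶠ l, _) = 0
      rw [map_finsum _ (tensorMode_locFin _ _ _ _ _ _)]
      refine finsum_eq_zero_of_forall_eq_zero fun l => ?_
      rw [TensorProduct.map_tmul, component, TensorProduct.map_tmul, Finsupp.lapply_apply, psi,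
        mode_exp_single _ _ _ _ _ _ _ h1, TensorProduct.zero_tmul]

theorem omegaTor_apply (m : ℤ) (w : Fock (Idx ℓ r) ⊗[ℂ] Fock (Idx ℓ r))
    (d : Lattice ℓ r × Lattice ℓ r) :
    omegaTor c m w d = ∑ k : Fin ℓ, ∑ᶠ q, component d.1 d.2
      (tensorMode (gram ℓ r) (epsBasis ℓ c) (psi k q) (psiStar k q) m w) := by
  rw [omegaTor, LinearMap.pi_apply, LinearMap.sum_apply]
  rfl

/-- Loop actions commute with all modes of the Casimir field: the two contributions cancel after a
shift of the summation index `q`. -/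
theorem IsLoopAction.omegaTor_diag {X : Module.End ℂ (Fock (Idx ℓ r))} (hX : IsLoopAction c X) :
    ∃ (δ : Lattice ℓ r), ∀ m w β γ, omegaTor c m (diag X w) (β, γ) =
      (homogPart δ X β).rTensor _ (omegaTor c m w (β - δ, γ)) +
        (homogPart δ X γ).lTensor _ (omegaTor c m w (β, γ - δ)) := by
  obtain ⟨δ, x, p, n, hδ, h1, h2⟩ := hX
  refine ⟨δ, fun m w β γ => ?_⟩
  let T : Fin ℓ → (Fin r → ℤ) → Fin ℓ → (Fin r → ℤ) → ℤ →
      Module.End ℂ (Fock (Idx ℓ r) ⊗[ℂ] Fock (Idx ℓ r)) := fun k q k' q' m =>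
    tensorMode (gram ℓ r) (epsBasis ℓ c) (psi k q) (psiStar k' q') m
  have hr : ∀ k q, T k q k q m (X.rTensor _ w) = X.rTensor _ (T k q k q m w) -
      ∑ i, x i k • T i (p + q) k q (n + m) w := fun k q =>
    eq_sub_of_add_eq (rTensor_tensorMode _ _ X _ _ (fun i => x i k) (fun i => psi i (p + q)) n
      (h1 k q) m w).symm
  have hl : ∀ k q, T k q k q m (X.lTensor _ w) = X.lTensor _ (T k q k q m w) +
      ∑ i, x k i • T k q i (q - p) (n + m) w := fun k q => by
    have := lTensor_tensorMode _ _ X (psi k q) _ (fun i => -x k i) (fun i => psiStar i (q - p)) n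
      (h2 k q) m w
    rw [this, add_assoc, ← Finset.sum_add_distrib, Finset.sum_eq_zero fun i _ => ?_, add_zero]
    exact (add_smul _ _ _).symm.trans (by rw [neg_add_cancel, zero_smul])
  have hfin := finite_component_tensorMode (ℓ := ℓ) c
  have F1 : ∀ k, (Function.support fun q => (homogPart δ X β).rTensor (Sym (Idx ℓ r))
      (component (β - δ) γ (T k q k q m w))).Finite := fun k =>
    (hfin k _ m (β - δ) γ w).subset fun q hq h0 => hq (by
      simp only at h0 ⊢
      rw [h0, map_zero])
  have F2 : ∀ k, (Function.support fun q => (homogPart δ X γ).lTensor (Sym (Idx ℓ r))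
      (component β (γ - δ) (T k q k q m w))).Finite := fun k =>
    (hfin k _ m β (γ - δ) w).subset fun q hq h0 => hq (by
      simp only at h0 ⊢
      rw [h0, map_zero])
  have F3 : ∀ k i, (Function.support fun q =>
      component β γ (T k q i (q - p) (n + m) w)).Finite := fun k i => hfin k _ _ β γ w
  have F4 : ∀ k i, (Function.support fun q =>
      component β γ (T i (p + q) k q (n + m) w)).Finite := fun k i => by
    refine ((F3 i k).preimage (Equiv.addLeft p).injective.injOn).subset fun q hq h0 => hq ?_
    simp only [Equiv.coe_addLeft, add_sub_cancel_left] at h0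
    exact h0
  have hshift : ∀ k i, ∑ᶠ q, component β γ (T i (p + q) k q (n + m) w) =
      ∑ᶠ q, component β γ (T i q k (q - p) (n + m) w) := fun k i => by
    refine Eq.trans ?_ (finsum_comp_equiv (Equiv.addLeft p))
    simp only [Equiv.coe_addLeft, add_sub_cancel_left]
  have hsum : ∀ (y : Fin ℓ → ℂ) (G : Fin ℓ → (Fin r → ℤ) → Sym (Idx ℓ r) ⊗[ℂ] Sym (Idx ℓ r)),
      (∀ i, (Function.support (G i)).Finite) →
      (Function.support fun q => ∑ i, y i • G i q).Finite ∧
      ∑ᶠ q, ∑ i, y i • G i q = ∑ i, y i • ∑ᶠ q, G i q := fun y G hG => by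
    have hG' : ∀ i, (Function.support fun q => y i • G i q).Finite := fun i =>
      (hG i).subset fun q hq h0 => hq (by simp only [h0, smul_zero])
    refine ⟨(Set.finite_iUnion hG').subset fun q hq => ?_, ?_⟩
    · obtain ⟨i, _, hi⟩ := Finset.exists_ne_zero_of_sum_ne_zero hq
      exact Set.mem_iUnion.mpr ⟨i, hi⟩
    · rw [finsum_sum_comm _ _ fun i _ => hG' i]
      exact Finset.sum_congr rfl fun i _ => (smul_finsum' _ (hG i)).symm
  have hterm : ∀ k, ∑ᶠ q, component β γ (T k q k q m (diag X w)) =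
      (homogPart δ X β).rTensor _ (∑ᶠ q, component (β - δ) γ (T k q k q m w)) +
      (homogPart δ X γ).lTensor _ (∑ᶠ q, component β (γ - δ) (T k q k q m w)) +
      (∑ i, x k i • ∑ᶠ q, component β γ (T k q i (q - p) (n + m) w) -
        ∑ i, x i k • ∑ᶠ q, component β γ (T i q k (q - p) (n + m) w)) := fun k => by
    obtain ⟨G3, e3⟩ := hsum (fun i => x k i)
      (fun i q => component β γ (T k q i (q - p) (n + m) w)) fun i => F3 k i
    obtain ⟨G4, e4⟩ := hsum (fun i => x i k)
      (fun i q => component β γ (T i (p + q) k q (n + m) w)) fun i => F4 k i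
    simp only [hshift] at e4
    rw [map_finsum _ (hfin k _ m (β - δ) γ w), map_finsum _ (hfin k _ m β (γ - δ) w), ← e3, ← e4,
      ← finsum_add_distrib (F1 k) (F2 k), ← finsum_sub_distrib G3 G4, ← finsum_add_distrib]
    · refine finsum_congr fun q => ?_
      rw [diag, LinearMap.add_apply, map_add, hr, hl, map_add, map_sub, map_add,
        hδ.component_rTensor, hδ.component_lTensor, map_sum, map_sum]
      simp only [map_smul]
      abel
    · exact ((F1 k).union (F2 k)).subset (Function.support_add _ _)
    · exact (G3.union G4).subset (Function.support_sub _ _)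
  rw [omegaTor_apply, omegaTor_apply, omegaTor_apply, Finset.sum_congr rfl fun k _ => hterm k,
    Finset.sum_add_distrib, Finset.sum_add_distrib, map_sum, map_sum, Finset.sum_sub_distrib,
    Finset.sum_comm (f := fun k i => x i k • _), sub_self, add_zero]

/-- The operators whose diagonal action preserves a subspace of `V ⊗ V` form a Lie algebra. -/
def diagStabilizer (K : Submodule ℂ (Fock (Idx ℓ r) ⊗[ℂ] Fock (Idx ℓ r))) :
    LieSubalgebra ℂ (Module.End ℂ (Fock (Idx ℓ r))) where
  carrier := {X | ∀ w ∈ K, diag X w ∈ K}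
  add_mem' := by
    intro X X' hX hX' w hw
    have : diag (X + X') w = diag X w + diag X' w := by
      simp only [diag, LinearMap.rTensor_add, LinearMap.lTensor_add, LinearMap.add_apply]
      abel
    rw [this]
    exact K.add_mem (hX w hw) (hX' w hw)
  zero_mem' := by
    intro w _
    simp [diag]
  smul_mem' := by
    intro z X hX w hw
    have : diag (z • X) w = z • diag X w := by
      simp only [diag, LinearMap.rTensor_smul, LinearMap.lTensor_smul, LinearMap.add_apply,
        LinearMap.smul_apply, smul_add]
    rw [this]
    exact K.smul_mem z (hX w hw)
  lie_mem' := by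
    intro X X' hX hX' w hw
    have hXX' : ⁅X, X'⁆ = X * X' - X' * X := rfl
    have h : diag ⁅X, X'⁆ + diag X' * diag X = diag X * diag X' := by
      refine TensorProduct.ext' fun a b => ?_
      simp only [diag, LinearMap.add_apply, LinearMap.sub_apply, Module.End.mul_apply,
        LinearMap.rTensor_tmul, LinearMap.lTensor_tmul, map_add, hXX',
        TensorProduct.sub_tmul, TensorProduct.tmul_sub]
      abel
    -- Written with `+` and `•` only, as `K` refers to `V ⊗ V` as an additive monoid.
    have h' : diag ⁅X, X'⁆ w = diag X (diag X' w) + (-1 : ℂ) • diag X' (diag X w) := by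
      have h1 : diag ⁅X, X'⁆ w + diag X' (diag X w) = diag X (diag X' w) :=
        LinearMap.congr_fun h w
      have h2 : diag X' (diag X w) + (-1 : ℂ) • diag X' (diag X w) = 0 := by
        nth_rw 1 [← one_smul ℂ (diag X' (diag X w))]
        rw [← add_smul, add_neg_cancel, zero_smul]
      rw [← h1, add_assoc, h2, add_zero]
    rw [h']
    exact K.add_mem (hX _ (hX' w hw)) (K.smul_mem _ (hX' _ (hX w hw)))

theorem IsLoopAction.mem_diagStabilizer {X : Module.End ℂ (Fock (Idx ℓ r))}
    (hX : IsLoopAction c X) (m : ℤ) : X ∈ diagStabilizer (LinearMap.ker (omegaTor c m)) := by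
  obtain ⟨δ, h⟩ := hX.omegaTor_diag
  intro w hw
  have hw' : omegaTor c m w = 0 := hw
  refine LinearMap.mem_ker.mpr (funext fun d => ?_)
  rw [h m w d.1 d.2, hw', Pi.zero_apply, Pi.zero_apply, map_zero, map_zero, add_zero]
  rfl

theorem omegaTor_vac {m : ℤ} (hm : 0 ≤ m) :
    omegaTor c m (vac (Idx ℓ r) ⊗ₜ vac (Idx ℓ r)) = 0 := by
  refine funext fun d => ?_
  rw [omegaTor_apply]
  refine Finset.sum_eq_zero fun k _ => finsum_eq_zero_of_forall_eq_zero fun q => ?_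
  rw [psi, psiStar, tensorMode_vac _ _ _ _ hm, map_zero]

end Casimir

/-! ### The generators of the toroidal Lie algebra -/

section Generators

variable {ℓ r : ℕ} (c : Fin r → Fin r → ℤˣ)

theorem gram_isSymm : (gram ℓ r).IsSymm := by
  refine Matrix.IsSymm.ext fun i j => ?_
  rcases i with i | i | i <;> rcases j with j | j | j <;> simp [gram, eq_comm]

theorem latForm_gram (α β : Lattice ℓ r) :
    latForm (gram ℓ r) α β = ∑ i, α (Sum.inl i) * β (Sum.inl i) +
      ∑ ν, (α (Sum.inr (Sum.inl ν)) * β (Sum.inr (Sum.inr ν)) +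
        α (Sum.inr (Sum.inr ν)) * β (Sum.inr (Sum.inl ν))) := by
  simp [latForm, gram, Fintype.sum_sum_type, Finset.sum_add_distrib, mul_ite, ite_mul]
  exact add_comm _ _

@[simp] theorem v_inl (i j : Fin ℓ) :
    (v i : Lattice ℓ r) (Sum.inl j) = if j = i then 1 else 0 := by
  simp [v, Pi.single_apply]

@[simp] theorem v_inr (i : Fin ℓ) (x : Fin r ⊕ Fin r) : (v i : Lattice ℓ r) (Sum.inr x) = 0 := by
  simp [v]

@[simp] theorem dotTh_inl (p : Fin r → ℤ) (j : Fin ℓ) : dotTh p (Sum.inl j) = 0 := by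
  simp [dotTh, th]

@[simp] theorem dotTh_inr_inr (p : Fin r → ℤ) (ν : Fin r) :
    (dotTh p : Lattice ℓ r) (Sum.inr (Sum.inr ν)) = 0 := by
  simp [dotTh, th, Finset.sum_apply]

theorem dotTh_add (p q : Fin r → ℤ) : (dotTh (p + q) : Lattice ℓ r) = dotTh p + dotTh q := by
  simp [dotTh, add_smul, Finset.sum_add_distrib]

theorem dotTh_sub (p q : Fin r → ℤ) : (dotTh (p - q) : Lattice ℓ r) = dotTh p - dotTh q := by
  simp [dotTh, sub_smul, Finset.sum_sub_distrib]

/-- Vectors without `Θ`-components: the sublattice spanned by the `v_i` and `θ_ν`. -/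
def NoTheta (α : Lattice ℓ r) : Prop := ∀ ν, α (Sum.inr (Sum.inr ν)) = 0

theorem latForm_gram_of_noTheta {α β : Lattice ℓ r} (hα : NoTheta α) (hβ : NoTheta β) :
    latForm (gram ℓ r) α β = ∑ i, α (Sum.inl i) * β (Sum.inl i) := by
  rw [latForm_gram, add_eq_left]
  exact Finset.sum_eq_zero fun ν _ => by rw [hα ν, hβ ν, mul_zero, zero_mul, add_zero]

theorem bimult_epsBasis_of_noTheta {α β : Lattice ℓ r} (hα : NoTheta α) (hβ : NoTheta β) :
    bimult (epsBasis ℓ c) α β =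
      ∏ i, ∏ j, epsQ i j ^ (α (Sum.inl i) * β (Sum.inl j)) := by
  simp [bimult, epsBasis, Fintype.prod_sum_type, hα _, hβ _]

theorem noTheta_dotTh (p : Fin r → ℤ) : NoTheta (dotTh p : Lattice ℓ r) := fun ν => by simp

theorem noTheta_v (i : Fin ℓ) : NoTheta (v i : Lattice ℓ r) := fun ν => by simp

theorem NoTheta.add {α β : Lattice ℓ r} (hα : NoTheta α) (hβ : NoTheta β) : NoTheta (α + β) :=
  fun ν => by rw [Pi.add_apply, hα, hβ, add_zero]

theorem NoTheta.neg {α : Lattice ℓ r} (hα : NoTheta α) : NoTheta (-α) :=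
  fun ν => by rw [Pi.neg_apply, hα, neg_zero]

theorem NoTheta.sub {α β : Lattice ℓ r} (hα : NoTheta α) (hβ : NoTheta β) : NoTheta (α - β) :=
  fun ν => by rw [Pi.sub_apply, hα, hβ, sub_zero]

theorem sgn_neg_left {ι : Type} [Fintype ι] (E : ι → ι → ℤˣ) (α β : ι → ℤ) :
    sgn E (-α) β = sgn E α β := by
  have : bimult E (-α) β = (bimult E α β)⁻¹ := by simp [bimult]
  rw [sgn, this, Int.units_inv_eq_self, sgn]

theorem sgn_neg_right {ι : Type} [Fintype ι] (E : ι → ι → ℤˣ) (α β : ι → ℤ) :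
    sgn E α (-β) = sgn E α β := by
  have : bimult E α (-β) = (bimult E α β)⁻¹ := by simp [bimult]
  rw [sgn, this, Int.units_inv_eq_self, sgn]

theorem sgn_dotTh_left (p : Fin r → ℤ) {β : Lattice ℓ r} (hβ : NoTheta β) :
    sgn (epsBasis ℓ c) (dotTh p) β = 1 := by
  rw [sgn, bimult_epsBasis_of_noTheta c (noTheta_dotTh p) hβ]
  simp

theorem sgn_dotTh_right (p : Fin r → ℤ) {β : Lattice ℓ r} (hβ : NoTheta β) :
    sgn (epsBasis ℓ c) β (dotTh p) = 1 := by
  rw [sgn, bimult_epsBasis_of_noTheta c hβ (noTheta_dotTh p)]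
  simp

theorem sgn_v_v (i j : Fin ℓ) : sgn (epsBasis ℓ c) (v i) (v j) = ((epsQ i j : ℤˣ) : ℤ) := by
  rw [sgn, bimult_epsBasis_of_noTheta c (noTheta_v i) (noTheta_v j), Finset.prod_eq_single i,
    Finset.prod_eq_single j]
  · simp
  · intro b _ hb; simp [hb]
  · simp
  · intro b _ hb; simp [hb]
  · simp

theorem epsQ_swap {i j : Fin ℓ} (h : i ≠ j) : epsQ i j = -epsQ j i := by
  rcases lt_or_gt_of_ne h with h | h <;> simp [epsQ, h, h.not_gt]

theorem epsQ_self (i : Fin ℓ) : epsQ i i = -1 := by simp [epsQ]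

theorem epsQ_mul_self (i j : Fin ℓ) : ((epsQ i j : ℤˣ) : ℤ) * ((epsQ i j : ℤˣ) : ℤ) = 1 := by
  rw [← Units.val_mul, Int.units_mul_self, Units.val_one]

theorem noTheta_psi (k : Fin ℓ) (q : Fin r → ℤ) : NoTheta (v k + dotTh q : Lattice ℓ r) :=
  (noTheta_v k).add (noTheta_dotTh q)

theorem noTheta_psiStar (k : Fin ℓ) (q : Fin r → ℤ) : NoTheta (-v k - dotTh q : Lattice ℓ r) :=
  (noTheta_v k).neg.sub (noTheta_dotTh q)

theorem latForm_dotTh_left (p : Fin r → ℤ) {β : Lattice ℓ r} (hβ : NoTheta β) :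
    latForm (gram ℓ r) (dotTh p) β = 0 := by
  rw [latForm_gram_of_noTheta (noTheta_dotTh p) hβ]
  simp

theorem latForm_dotTh_right (p : Fin r → ℤ) {β : Lattice ℓ r} (hβ : NoTheta β) :
    latForm (gram ℓ r) β (dotTh p) = 0 := by
  rw [latForm_gram_of_noTheta hβ (noTheta_dotTh p)]
  simp

/-- The commutator of a mode of `h s^{-1} ⊗ e^{p·θ}` with a mode of `e^β`. -/
theorem torMode_hs_commutator (h β : Lattice ℓ r) (hβ : NoTheta β) (p : Fin r → ℤ) (n m : ℤ) :
    torMode c (Finsupp.single (dotTh p) (hs (toC h) 0)) n * torMode c (Finsupp.single β 1) m -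
      torMode c (Finsupp.single β 1) m * torMode c (Finsupp.single (dotTh p) (hs (toC h) 0)) n =
      (latForm (gram ℓ r) h β : ℂ) • torMode c (Finsupp.single (β + dotTh p) 1) (n + m) := by
  have h1 := mode_hs_commutator (epsBasis ℓ c) gram_isSymm (toC h)
    (latForm_dotTh_left p hβ) (latForm_dotTh_right p hβ)
    (by rw [sgn_dotTh_left c p hβ, sgn_dotTh_right c p hβ]) n m
  rwa [sgn_dotTh_right c p hβ, mul_one, hForm_toC] at h1

/-- A mode of `h s^{-1} ⊗ e^{p·θ}` acts as a diagonal matrix, if `h` is orthogonal to the `θ_ν`. -/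
theorem isLoopAction_hs {h : Lattice ℓ r} (hh : NoTheta h) (p : Fin r → ℤ) (n : ℤ) :
    IsLoopAction c (torMode c (Finsupp.single (dotTh p) (hs (toC h) 0)) n) := by
  refine ⟨dotTh p, fun a b => if a = b then (h (Sum.inl a) : ℂ) else 0, p, n,
    isHomog_mode_single_hs _ _ _ _ _, fun k q l => ?_, fun k q l => ?_⟩
  · have h1 : latForm (gram ℓ r) h (v k + dotTh q) = h (Sum.inl k) := by
      rw [latForm_gram_of_noTheta hh (noTheta_psi k q)]
      simp
    rw [psi, torMode_hs_commutator c h _ (noTheta_psi k q), h1, Finset.sum_eq_single k]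
    · beta_reduce
      rw [if_pos rfl, psi, dotTh_add, add_comm (dotTh p), add_assoc]
    · intro b _ hb
      beta_reduce
      rw [if_neg hb, zero_smul]
    · simp
  · have h1 : latForm (gram ℓ r) h (-v k - dotTh q) = -h (Sum.inl k) := by
      rw [latForm_gram_of_noTheta hh (noTheta_psiStar k q)]
      simp
    rw [psiStar, torMode_hs_commutator c h _ (noTheta_psiStar k q), h1, Finset.sum_eq_single k]
    · beta_reduce
      rw [if_pos rfl, psiStar, dotTh_sub, sub_sub_eq_add_sub, sub_add_eq_add_sub, Int.cast_neg]
    · intro b _ hb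
      beta_reduce
      rw [if_neg hb.symm, neg_zero, zero_smul]
    · simp

theorem isLoopAction_kapZeroOp (p : Fin r → ℤ) (n : ℤ) :
    IsLoopAction c (kapZeroOp ℓ c p n) := by
  have h : ∀ β : Lattice ℓ r, NoTheta β → ∀ l,
      kapZeroOp ℓ c p n * torMode c (Finsupp.single β 1) l -
        torMode c (Finsupp.single β 1) l * kapZeroOp ℓ c p n = 0 := fun β hβ l => by
    rw [kapZeroOp, torMode, torMode, mode_single_one, mode_single_one]
    exact sub_eq_zero_of_eq (expFieldCoeff_commute_of_zero _ _ (latForm_dotTh_left p hβ)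
      (latForm_dotTh_right p hβ) (by rw [sgn_dotTh_left c p hβ, sgn_dotTh_right c p hβ]) _ _)
  refine ⟨dotTh p, fun _ _ => 0, 0, 0, isHomog_mode_single_one _ _ _ _, fun k q l => ?_,
    fun k q l => ?_⟩
  · rw [psi, h _ (noTheta_psi k q)]
    simp
  · rw [psiStar, h _ (noTheta_psiStar k q)]
    simp

theorem latForm_root (i l k : Fin ℓ) (p q : Fin r → ℤ) :
    latForm (gram ℓ r) (v i - v l + dotTh p) (v k + dotTh q) =
      (if k = i then 1 else 0) - if k = l then 1 else 0 := by
  rw [latForm_gram_of_noTheta (((noTheta_v i).sub (noTheta_v l)).add (noTheta_dotTh p))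
    (noTheta_psi k q)]
  simp

theorem latForm_neg_right {ι : Type} [Fintype ι] (B : Matrix ι ι ℤ) (α β : ι → ℤ) :
    latForm B α (-β) = -latForm B α β := by
  simp [latForm, Finset.sum_neg_distrib]

theorem latForm_comm {ι : Type} [Fintype ι] {B : Matrix ι ι ℤ} (hB : B.IsSymm) (α β : ι → ℤ) :
    latForm B α β = latForm B β α := by
  rw [latForm, Finset.sum_comm, latForm]
  refine Finset.sum_congr rfl fun i _ => Finset.sum_congr rfl fun j _ => ?_
  rw [hB.apply i j]
  ring

theorem sgn_root_left (i l k : Fin ℓ) (p q : Fin r → ℤ) :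
    sgn (epsBasis ℓ c) (v i - v l + dotTh p) (v k + dotTh q) =
      ((epsQ i k : ℤˣ) : ℤ) * ((epsQ l k : ℤˣ) : ℤ) := by
  rw [sgn_add_left, sgn_add_right, sub_eq_add_neg, sgn_add_left, sgn_neg_left, sgn_v_v, sgn_v_v,
    sgn_dotTh_right c q ((noTheta_v i).add (noTheta_v l).neg),
    sgn_dotTh_left c p (noTheta_psi k q), mul_one, mul_one]

theorem sgn_root_right (i l k : Fin ℓ) (p q : Fin r → ℤ) :
    sgn (epsBasis ℓ c) (v k + dotTh q) (v i - v l + dotTh p) =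
      ((epsQ k i : ℤˣ) : ℤ) * ((epsQ k l : ℤˣ) : ℤ) := by
  rw [sgn_add_right, sgn_add_left, sub_eq_add_neg, sgn_add_right, sgn_neg_right, sgn_v_v, sgn_v_v,
    sgn_dotTh_left c q ((noTheta_v i).add (noTheta_v l).neg),
    sgn_dotTh_right c p (noTheta_psi k q), mul_one, mul_one]

/-- The operator `e_{il,n}^p` acts as the matrix unit `E_{il}`. -/
theorem isLoopAction_eOp {i l : Fin ℓ} (hil : i ≠ l) (p : Fin r → ℤ) (n : ℤ) :
    IsLoopAction c (eOp c i l p n) := by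
  have hXi : eOp c i l p n = (((epsQ l i : ℤˣ) : ℤ) : ℂ) •
      expFieldCoeff (gram ℓ r) (epsBasis ℓ c) (v i - v l + dotTh p) (-n - 1) := by
    rw [eOp, torMode, mode_single_one]
    refine LinearMap.ext fun u => ?_
    rcases Int.units_eq_one_or (epsQ l i) with h | h <;> simp [h]
  have hform : ∀ (α β : Lattice ℓ r), latForm (gram ℓ r) β α = latForm (gram ℓ r) α β :=
    fun α β => latForm_comm gram_isSymm _ _
  have hstar : ∀ (k : Fin ℓ) (q : Fin r → ℤ),
      (-v k - dotTh q : Lattice ℓ r) = -(v k + dotTh q) := fun k q => (neg_add' _ _).symm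
  -- For `k ≠ i, l` the two signs agree, and for `k = i` or `k = l` they are opposite.
  have hs0 : ∀ k q, k ≠ i → k ≠ l →
      sgn (epsBasis ℓ c) (v i - v l + dotTh p) (v k + dotTh q) =
        sgn (epsBasis ℓ c) (v k + dotTh q) (v i - v l + dotTh p) := fun k q hi hl => by
    rw [sgn_root_left, sgn_root_right, epsQ_swap hi.symm, epsQ_swap hl.symm]
    push_cast
    ring
  have hs1 : ∀ k q, k = i ∨ k = l →
      sgn (epsBasis ℓ c) (v i - v l + dotTh p) (v k + dotTh q) =
        -sgn (epsBasis ℓ c) (v k + dotTh q) (v i - v l + dotTh p) := fun k q hk => by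
    rw [sgn_root_left, sgn_root_right]
    rcases hk with rfl | rfl
    · rw [epsQ_swap hil]
      push_cast
      ring
    · rw [epsQ_swap hil]
      push_cast
      ring
  have hcomm : ∀ β : Lattice ℓ r, (∀ a b, Commute
      (expFieldCoeff (gram ℓ r) (epsBasis ℓ c) (v i - v l + dotTh p) a)
      (expFieldCoeff (gram ℓ r) (epsBasis ℓ c) β b)) → ∀ j,
      eOp c i l p n * torMode c (Finsupp.single β 1) j -
        torMode c (Finsupp.single β 1) j * eOp c i l p n = 0 := fun β hβ j => by
    rw [hXi, torMode, mode_single_one]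
    exact sub_eq_zero_of_eq ((hβ _ _).smul_left _)
  have hbr : ∀ β : Lattice ℓ r, latForm (gram ℓ r) (v i - v l + dotTh p) β = -1 →
      sgn (epsBasis ℓ c) (v i - v l + dotTh p) β =
        -sgn (epsBasis ℓ c) β (v i - v l + dotTh p) → ∀ j,
      eOp c i l p n * torMode c (Finsupp.single β 1) j -
        torMode c (Finsupp.single β 1) j * eOp c i l p n =
        ((((epsQ l i : ℤˣ) : ℤ) : ℂ) * sgn (epsBasis ℓ c) (v i - v l + dotTh p) β) •
          torMode c (Finsupp.single (v i - v l + dotTh p + β) 1) (n + j) := fun β hf hsβ j => by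
    rw [hXi, torMode, torMode, mode_single_one, mode_single_one, smul_mul_assoc, mul_smul_comm]
    have hsub := smul_sub (((epsQ l i : ℤˣ) : ℤ) : ℂ)
      (expFieldCoeff (gram ℓ r) (epsBasis ℓ c) (v i - v l + dotTh p) (-n - 1) *
        expFieldCoeff (gram ℓ r) (epsBasis ℓ c) β (-j - 1))
      (expFieldCoeff (gram ℓ r) (epsBasis ℓ c) β (-j - 1) *
        expFieldCoeff (gram ℓ r) (epsBasis ℓ c) (v i - v l + dotTh p) (-n - 1))
    refine hsub.symm.trans ?_
    rw [expFieldCoeff_commutator_of_neg_one _ _ hf (by rw [hform, hf]) hsβ, smul_smul,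
      show -n - 1 + (-j - 1) + 1 = -(n + j) - 1 by ring]
  refine ⟨v i - v l + dotTh p, fun a b => if a = i ∧ b = l then 1 else 0, p, n, ?_,
    fun k q j => ?_, fun k q j => ?_⟩
  · rw [hXi]
    exact (isHomog_expFieldCoeff _ _ _ _).smul _
  · rw [psi]
    by_cases hkl : k = l
    · rw [hkl, hbr _ (by rw [latForm_root]; simp [hil.symm]) (hs1 l q (Or.inr rfl)),
        sgn_root_left, epsQ_self, epsQ_swap hil, Finset.sum_eq_single i]
      · have e : (v i - v l + dotTh p + (v l + dotTh q) : Lattice ℓ r) =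
            v i + dotTh (p + q) := by rw [dotTh_add]; abel
        have h1 : (((epsQ l i : ℤˣ) : ℤ) : ℂ) * ((epsQ l i : ℤˣ) : ℤ) = 1 := by
          exact_mod_cast epsQ_mul_self l i
        rw [e, psi]
        congr 1
        push_cast
        simpa using h1
      · intro b _ hb
        simp [hb]
      · simp
    · rw [hcomm]
      · simp [hkl]
      · by_cases hki : k = i
        · have := latForm_root i l k p q
          rw [if_pos hki, if_neg hkl, sub_zero] at this
          exact expFieldCoeff_commute_of_one _ _ this (by rw [hform, this])
            (hs1 k q (Or.inl hki))
        · have := latForm_root i l k p q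
          rw [if_neg hki, if_neg hkl, sub_zero] at this
          exact expFieldCoeff_commute_of_zero _ _ this (by rw [hform, this]) (hs0 k q hki hkl)
  · rw [psiStar, hstar]
    by_cases hki : k = i
    · rw [hki, hbr _ (by rw [latForm_neg_right, latForm_root]; simp [hil])
        (by rw [sgn_neg_right, sgn_neg_left]; exact hs1 i q (Or.inl rfl)), sgn_neg_right,
        sgn_root_left, epsQ_self, Finset.sum_eq_single l]
      · have e : (v i - v l + dotTh p + -(v i + dotTh q) : Lattice ℓ r) =
            -v l - dotTh (q - p) := by rw [dotTh_sub]; abel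
        have h1 : (((epsQ l i : ℤˣ) : ℤ) : ℂ) * ((epsQ l i : ℤˣ) : ℤ) = 1 := by
          exact_mod_cast epsQ_mul_self l i
        rw [e, psiStar]
        congr 1
        push_cast
        simpa using h1
      · intro b _ hb
        simp [hb]
      · simp
    · rw [hcomm]
      · simp [hki]
      · by_cases hkl : k = l
        · have := latForm_root i l k p q
          rw [if_neg hki, if_pos hkl, zero_sub] at this
          have h2 : latForm (gram ℓ r) (v i - v l + dotTh p) (-(v k + dotTh q)) = 1 := by
            rw [latForm_neg_right, this, neg_neg]
          exact expFieldCoeff_commute_of_one _ _ h2 (by rw [hform, h2])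
            (by rw [sgn_neg_right, sgn_neg_left]; exact hs1 k q (Or.inr hkl))
        · have := latForm_root i l k p q
          rw [if_neg hki, if_neg hkl, sub_zero] at this
          have h2 : latForm (gram ℓ r) (v i - v l + dotTh p) (-(v k + dotTh q)) = 0 := by
            rw [latForm_neg_right, this, neg_zero]
          exact expFieldCoeff_commute_of_zero _ _ h2 (by rw [hform, h2])
            (by rw [sgn_neg_right, sgn_neg_left]; exact hs0 k q hki hkl)

theorem gTor_le_diagStabilizer (m : ℤ) :
    gTor ℓ c ≤ diagStabilizer (LinearMap.ker (omegaTor c m)) := by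
  refine LieSubalgebra.lieSpan_le.mpr ?_
  rintro X (((⟨i, j, _, p, n, rfl⟩ | ⟨k, l, hkl, p, n, rfl⟩) | ⟨p, n, rfl⟩) | ⟨ν, p, n, rfl⟩)
  · exact (isLoopAction_hs c ((noTheta_v i).sub (noTheta_v j)) p n).mem_diagStabilizer c m
  · exact (isLoopAction_eOp c hkl p n).mem_diagStabilizer c m
  · exact (isLoopAction_kapZeroOp c p n).mem_diagStabilizer c m
  · exact (isLoopAction_hs c (h := th ν) (fun μ => by simp [th]) p n).mem_diagStabilizer c m

end Generators

/-! ### Weakly convergent series -/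

section WeakSum

variable {V : Type*} [AddCommGroup V] [Module ℂ V]

/-- A series that converges against all linear functionals has terms in a finite-dimensional
subspace: otherwise some functional would be `1` on infinitely many of its terms. -/
theorem finiteDimensional_span_of_weakSum {x : ℕ → V}
    (hx : ∀ f : Module.Dual ℂ V, Summable fun n => f (x n)) :
    FiniteDimensional ℂ (Submodule.span ℂ (Set.range x)) := by
  obtain ⟨b, hb, hspan, hli⟩ := exists_linearIndependent ℂ (Set.range x)
  rw [← hspan]
  have hli' : LinearIndepOn ℂ id b := hli
  -- The functional that is `1` on a basis extending `b`.
  let e := Module.Basis.extend hli'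
  let f : Module.Dual ℂ V := e.constr ℂ fun _ => (1 : ℂ)
  have hf : ∀ u ∈ b, f u = 1 := fun u hu => by
    have h1 := e.constr_basis ℂ (fun _ => (1 : ℂ)) ⟨u, hli'.subset_extend _ hu⟩
    rwa [Module.Basis.extend_apply_self] at h1
  choose! g hg using hb
  have hinj : Set.InjOn g b := fun u hu u' hu' h => by rw [← hg hu, h, hg hu']
  have hfin : (g '' b).Finite := by
    have h1 := (hx f).tendsto_cofinite_zero.eventually
      (Metric.ball_mem_nhds (0 : ℂ) one_pos)
    refine (Filter.eventually_cofinite.mp h1).subset ?_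
    rintro _ ⟨u, hu, rfl⟩
    simp [hg hu, hf u hu]
  exact FiniteDimensional.span_of_finite ℂ (hfin.of_finite_image hinj)

/-- The Cauchy product of a weakly convergent series with itself, for a bilinear form. -/
theorem apply_self_eq_zero_of_weakSum {x : ℕ → V} {Z : V}
    (hx : ∀ f : Module.Dual ℂ V, HasSum (fun n => f (x n)) (f Z)) (φ : V →ₗ[ℂ] V →ₗ[ℂ] ℂ)
    (hφ : ∀ n, ∑ p ∈ Finset.HasAntidiagonal.antidiagonal n, φ (x p.1) (x p.2) = 0) :
    φ Z Z = 0 := by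
  set W := Submodule.span ℂ (Set.range x)
  have : FiniteDimensional ℂ W := finiteDimensional_span_of_weakSum fun f => (hx f).summable
  have hxW : ∀ n, x n ∈ W := fun n => Submodule.subset_span ⟨n, rfl⟩
  have hZ : Z ∈ W := by
    by_contra hZ
    obtain ⟨f, hf, hfZ⟩ := LinearMap.exists_extend_of_notMem (0 : W →ₗ[ℂ] ℂ) hZ 1
    have h1 : ∀ n, f (x n) = 0 := fun n => LinearMap.congr_fun hf ⟨x n, hxW n⟩
    have h2 := (hx f).unique (by simpa only [h1] using hasSum_zero)
    rw [hfZ] at h2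
    exact one_ne_zero h2
  let e := Module.finBasis ℂ W
  choose f hf using fun i => LinearMap.exists_extend (e.coord i)
  have hexp : ∀ u ∈ W, u = ∑ i, f i u • (e i : V) := fun u hu => by
    have h1 := congrArg Subtype.val (e.sum_repr ⟨u, hu⟩)
    rw [Submodule.coe_sum] at h1
    refine h1.symm.trans (Finset.sum_congr rfl fun i _ => ?_)
    have h2 : f i u = e.repr ⟨u, hu⟩ i := LinearMap.congr_fun (hf i) ⟨u, hu⟩
    rw [h2]
    rfl
  have hφexp : ∀ u ∈ W, ∀ w ∈ W, φ u w = ∑ i, ∑ j, f i u * f j w * φ (e i) (e j) :=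
    fun u hu w hw => by
      conv_lhs => rw [hexp u hu, hexp w hw]
      simp only [map_sum, map_smul, LinearMap.sum_apply, LinearMap.smul_apply, smul_eq_mul,
        Finset.mul_sum]
      rw [Finset.sum_comm]
      exact Finset.sum_congr rfl fun i _ => Finset.sum_congr rfl fun j _ => by ring
  have hprod : ∀ i j, HasSum (fun n => ∑ p ∈ Finset.HasAntidiagonal.antidiagonal n,
      f i (x p.1) * f j (x p.2)) (f i Z * f j Z) := fun i j => by
    have hi := (hx (f i)).summable.norm
    have hj := (hx (f j)).summable.norm
    have h1 := (summable_norm_sum_mul_antidiagonal_of_summable_norm hi hj).of_norm.hasSum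
    rwa [← tsum_mul_tsum_eq_tsum_sum_antidiagonal_of_summable_norm hi hj, (hx (f i)).tsum_eq,
      (hx (f j)).tsum_eq] at h1
  have htot : HasSum (fun n => ∑ p ∈ Finset.HasAntidiagonal.antidiagonal n, φ (x p.1) (x p.2))
      (φ Z Z) := by
    rw [hφexp Z hZ Z hZ]
    have h1 := hasSum_sum (s := Finset.univ) fun i _ => hasSum_sum (s := Finset.univ) fun j _ =>
      (hprod i j).mul_right (φ (e i) (e j))
    refine h1.congr_fun fun n => ?_
    rw [Finset.sum_congr rfl fun p _ => hφexp _ (hxW p.1) _ (hxW p.2), Finset.sum_comm]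
    refine Finset.sum_congr rfl fun i _ => ?_
    rw [Finset.sum_comm]
    exact Finset.sum_congr rfl fun j _ => (Finset.sum_mul _ _ _).symm
  simp only [hφ] at htot
  exact htot.unique hasSum_zero

end WeakSum

/-! ### The exponential of an element of the toroidal Lie algebra -/

section Exponential

variable {ℓ r : ℕ} (c : Fin r → Fin r → ℤˣ)

/-- The degree `n` part of `e^{tX} |0⟩ ⊗ e^{tX} |0⟩` is `(X ⊗ 1 + 1 ⊗ X)^n / n!` applied to
`|0⟩ ⊗ |0⟩`. -/
theorem sum_expTermVac_tmul (X : Module.End ℂ (Fock (Idx ℓ r))) (n : ℕ) :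
    ∑ p ∈ Finset.HasAntidiagonal.antidiagonal n, expTermVac X p.1 ⊗ₜ[ℂ] expTermVac X p.2 =
      ((Nat.factorial n : ℂ))⁻¹ • (diag X ^ n) (vac _ ⊗ₜ vac _) := by
  have hcomm : Commute (X.rTensor (Fock (Idx ℓ r))) (X.lTensor (Fock (Idx ℓ r))) :=
    TensorProduct.ext' fun a b => by simp
  rw [diag, hcomm.add_pow', LinearMap.sum_apply, Finset.smul_sum]
  refine Finset.sum_congr rfl fun p hp => ?_
  have hp' := Finset.HasAntidiagonal.mem_antidiagonal.mp hp
  have h1 : ((X.rTensor (Fock (Idx ℓ r))) ^ p.1 * (X.lTensor (Fock (Idx ℓ r))) ^ p.2)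
      (vac _ ⊗ₜ vac _) = (X ^ p.1) (vac _) ⊗ₜ (X ^ p.2) (vac _) := by
    have hr : (X.rTensor (Fock (Idx ℓ r))) ^ p.1 = (X ^ p.1).rTensor _ :=
      LinearMap.rTensor_pow _ _
    have hl : (X.lTensor (Fock (Idx ℓ r))) ^ p.2 = (X ^ p.2).lTensor _ :=
      LinearMap.lTensor_pow _ _
    rw [hr, hl, Module.End.mul_apply, LinearMap.lTensor_tmul, LinearMap.rTensor_tmul]
  rw [LinearMap.smul_apply, h1, expTermVac, expTermVac, TensorProduct.smul_tmul_smul,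
    ← Nat.cast_smul_eq_nsmul ℂ, smul_smul]
  congr 1
  rw [← hp', Nat.cast_add_choose]
  have h2 : ((p.1 + p.2).factorial : ℂ) ≠ 0 := by exact_mod_cast Nat.factorial_ne_zero _
  field_simp

theorem omegaTor_sum_expTermVac {X : Module.End ℂ (Fock (Idx ℓ r))} (hX : X ∈ gTor ℓ c) {m : ℤ}
    (hm : 0 ≤ m) (n : ℕ) :
    omegaTor c m (∑ p ∈ Finset.HasAntidiagonal.antidiagonal n,
      expTermVac X p.1 ⊗ₜ[ℂ] expTermVac X p.2) = 0 := by
  have hmem : (diag X ^ n) (vac _ ⊗ₜ vac _) ∈ LinearMap.ker (omegaTor c m) := by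
    induction n with
    | zero => exact omegaTor_vac c hm
    | succ n ih =>
      rw [pow_succ', Module.End.mul_apply]
      exact gTor_le_diagStabilizer c m hX _ ih
  rw [sum_expTermVac_tmul, map_smul, LinearMap.mem_ker.mp hmem, smul_zero]

theorem omegaTor_tmul_self_of_isExpVac {X : Module.End ℂ (Fock (Idx ℓ r))} (hX : X ∈ gTor ℓ c)
    {Z : Fock (Idx ℓ r)} (hZ : IsExpVac X Z) {m : ℤ} (hm : 0 ≤ m) :
    omegaTor c m (Z ⊗ₜ[ℂ] Z) = 0 := by
  refine funext fun d => (Module.forall_dual_apply_eq_zero_iff ℂ _).mp fun f => ?_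
  let φ : Fock (Idx ℓ r) →ₗ[ℂ] Fock (Idx ℓ r) →ₗ[ℂ] ℂ :=
    (TensorProduct.mk ℂ _ _).compr₂ (f ∘ₗ LinearMap.proj d ∘ₗ omegaTor c m)
  refine apply_self_eq_zero_of_weakSum hZ φ fun n => ?_
  have h1 : ∀ u w, φ u w = (f ∘ₗ LinearMap.proj d ∘ₗ omegaTor c m) (u ⊗ₜ w) := fun _ _ => rfl
  simp only [h1]
  rw [← map_sum, LinearMap.comp_apply, LinearMap.comp_apply, omegaTor_sum_expTermVac c hX hm,
    map_zero, map_zero]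

end Exponential

end ToroidalVertex

end

theorem mainTheorem5 (ℓ r : ℕ) (c : Fin r → Fin r → ℤˣ)
    (X : Module.End ℂ (ToroidalVertex.Fock (ToroidalVertex.Idx ℓ r)))
    (hX : X ∈ ToroidalVertex.gTor ℓ c) :
    (∀ Z : ToroidalVertex.Fock (ToroidalVertex.Idx ℓ r), ToroidalVertex.IsExpVac X Z →
      ∀ m : ℤ, 0 ≤ m → ToroidalVertex.omegaTor c m (Z ⊗ₜ[ℂ] Z) = 0) ∧
    (∀ n : ℕ, ∀ m : ℤ, 0 ≤ m →
      ToroidalVertex.omegaTor c m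
        (∑ p ∈ Finset.HasAntidiagonal.antidiagonal n,
          ToroidalVertex.expTermVac X p.1 ⊗ₜ[ℂ] ToroidalVertex.expTermVac X p.2) = 0) :=
  ⟨fun _ hZ _ hm => ToroidalVertex.omegaTor_tmul_self_of_isExpVac c hX hZ hm,
    fun n _ hm => ToroidalVertex.omegaTor_sum_expTermVac c hX hm n⟩
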